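/- Let $k$ be a field of characteristic zero and let $V$ be an irreducible variety over $k$ (an integral separated scheme of finite type over $k$) with function field $K$. Let $\mathcal F$ be a singular foliation on $V$, that is, a $K$-linear subspace of $\mathrm{Der}_k(K,K)$ closed under the Lie bracket; let $r=\dim_K\mathcal F$ and let $\delta_1,\dots,\delta_r$ be a $K$-basis of $\mathcal F$. Let $I\neq 0$ be a coherent sheaf of ideals on $V$. For a torsion-free coherent subsheaf $M\subset K$ of rank one, let $P(M)\subset K^{r+1}$ be the sheaf of first principal parts of $M$ along $\mathcal F$, generated over $\mathcal O_V$ by the rows $(f,\delta_1f,\dots,\delta_rf)$ with $f\in M$, and let $F(M)=\Lambda^{r+1}P(M)/\text{torsion}$, embedded in $\Lambda^{r+1}_K K^{r+1}=K$ by the determinant. Products of sheaves are tensor products modulo torsion (products inside $K$). In characteristic zero $F(M)^{r+2}\subset F(M\,F(M))$ inside $K$; this inclusion is called the natural map. Put $$J_0=I,\qquad L_i=F(J_i),\qquad J_{i+1}=I\,L_0L_1\cdots L_i ,$$ and let $R(I)=\bigoplus_{i\ge 0}R_i$ with $R_0=\mathcal O_V$ and $R_i=L_0^{a_0}L_1^{a_1}\cdots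 L_s^{a_s}$, where $i=\sum_{\alpha}a_\alpha(r+2)^\alpha$, $0\le a_\alpha<r+2$, is the base $(r+2)$ expansion of $i$. By the natural maps $L_i^{r+2}\to L_{i+1}$ this is a sheaf of graded $\mathcal O_V$-subalgebras of $K[T]$, with $R_i$ in degree $i$. Let $V_0\to V$ be the blowup of $I$, and for $n\ge 0$ let $V_{n+1}\to V_n$ be the Gauss blowup along the foliation: the closure of the graph of the Gauss map of $V_n$, i.e. the blowup of $V_n$ along $\Lambda^r\Omega/\text{torsion}$, where $\Omega$ is the image of $\Omega_{V_n/k}$ in the dual of $\mathcal F$ under $dx\mapsto(\delta\mapsto\delta x)$. Then the following are equivalent: 1. $R(I)$ is of finite type over $k$: for every non-empty affine open $U\subset V$ the algebra $R(I)(U)$ is a finitely generated $k$-algebra. 2. The tower $\cdots\to V_2\to V_1\to V_0$ stabilizes: there is $N$ such that $V_{n+1}\to V_n$ is an isomorphism for all $n\ge N$. 3. There is $t\ge 0$ such that, for $J=J_t=I\,L_0\cdots L_{t-1}$, the natural map $F(J)^{r+2}\to F(J\,F(J))$ is an isomorphism. -/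

import Mathlib

open AlgebraicGeometry CategoryTheory Polynomial

universe u

namespace GaussProcess

noncomputable section

/-! ### The function field of a variety over `k` -/

section FunctionField

variable {k : Type u} [Field k] {V : Scheme.{u}} [V.Over (Spec (CommRingCat.of k))]

/-- The structure map `k → Γ(V, U)` of a `k`-scheme `V`. -/
def structureMap (k : Type u) [Field k] (V : Scheme.{u}) [V.Over (Spec (CommRingCat.of k))]
    (U : V.Opens) : k →+* Γ(V, U) :=
  (V.presheaf.map (homOfLE (le_top : U ≤ ⊤)).op).hom.comp
    ((V ↘ Spec (CommRingCat.of k)).appTop.hom.comp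
      (Scheme.ΓSpecIso (CommRingCat.of k)).inv.hom)

instance sectionsAlgebra (U : V.Opens) : Algebra k Γ(V, U) :=
  (structureMap k V U).toAlgebra

/-- The function field of an integral scheme over `k` is a field extension of `k`. -/
instance functionFieldAlgebra [IsIntegral V] : Algebra k V.functionField :=
  haveI : Nonempty (⊤ : V.Opens) := ⟨⟨genericPoint V, trivial⟩⟩
  ((V.germToFunctionField ⊤).hom.comp (structureMap k V ⊤)).toAlgebra

instance sections_isScalarTower [IsIntegral V] (U : V.Opens) [Nonempty U] :
    IsScalarTower k Γ(V, U) V.functionField := by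
  refine IsScalarTower.of_algebraMap_eq fun a => ?_
  have : Nonempty (⊤ : V.Opens) := ⟨⟨genericPoint V, trivial⟩⟩
  change (V.germToFunctionField ⊤).hom (structureMap k V ⊤ a) =
    (V.germToFunctionField U).hom (structureMap k V U a)
  simp only [structureMap, RingHom.comp_apply]
  erw [V.presheaf.germ_res_apply, V.presheaf.germ_res_apply]

end FunctionField

/-- A singular foliation with function field `K / k`: a `K`-linear subspace of `Der_k(K, K)` that is
closed under the Lie bracket of derivations. -/
structure SingularFoliation (k K : Type u) [Field k] [Field K] [Algebra k K] where
  /-- The underlying `K`-linear space of rational vector fields. -/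
  toSubmodule : Submodule K (Derivation k K K)
  /-- Involutivity. -/
  lie_mem : ∀ D ∈ toSubmodule, ∀ E ∈ toSubmodule, ⁅D, E⁆ ∈ toSubmodule

/-! ### Exterior powers modulo torsion, differentials and principal parts

All torsion-free sheaves below are subsheaves of constant sheaves on the function field `K`; on an
affine open with coordinate ring `A` they are `A`-submodules of `K` or of `Kⁿ`. In particular the
reduced tensor product `(M ⊗ N) / torsion` of `M, N ⊆ K` is the product `M * N ⊆ K`. -/

section Local

variable {k : Type*} {K : Type u} [Field k] [Field K] [Algebra k K]
variable {A : Type*} [CommRing A] [Algebra A K]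

/-- The determinant of `n` vectors in `Kⁿ`, as an `A`-multilinear alternating map. -/
def detAlternating (A : Type*) {K : Type*} [CommRing A] [Field K] [Algebra A K] (n : ℕ) :
    (Fin n → K) [⋀^Fin n]→ₗ[A] K :=
  { (Matrix.detRowAlternating (n := Fin n) (R := K)).toMultilinearMap.restrictScalars A with
    map_eq_zero_of_eq' := fun v _ _ h hij =>
      (Matrix.detRowAlternating (n := Fin n) (R := K)).map_eq_zero_of_eq v h hij }

/-- `⋀ⁿ P / torsion` for an `A`-submodule `P ⊆ Kⁿ` of full rank `n`. It is realised as the image of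
`⋀ⁿ_A P` in the generic fibre `⋀ⁿ_K Kⁿ = K`, the identification being the determinant. -/
def topExterior {n : ℕ} (P : Submodule A (Fin n → K)) : Submodule A K :=
  LinearMap.range
    (exteriorPower.alternatingMapLinearEquiv ((detAlternating A n).compLinearMap P.subtype))

/-- The differentials along the foliation with basis `δ`: the image of `Ω_{A/k}` in the dual space
of the foliation, `dx ↦ (δ ↦ δ x)`, in the coordinates given by the basis. -/
def differentials {r : ℕ} (δ : Fin r → Derivation k K K) (A : Type*) [CommRing A] [Algebra A K] :
    Submodule A (Fin r → K) :=
  Submodule.span A (Set.range fun (a : A) (i : Fin r) => δ i (algebraMap A K a))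

/-- The canonical sheaf `⋀ʳ Ω / torsion` of the foliation. -/
def canonical {r : ℕ} (δ : Fin r → Derivation k K K) (A : Type*) [CommRing A] [Algebra A K] :
    Submodule A K :=
  topExterior (differentials δ A)

/-- The first order jet `(f, δ₁ f, …, δᵣ f)` of a rational function along the foliation. -/
def jet {r : ℕ} (δ : Fin r → Derivation k K K) (f : K) : Fin (r + 1) → K :=
  Fin.cons f fun i => δ i f

/-- The module `P(I)` of first principal parts of `I` along the foliation, generated over `A` by the
jets of the elements of `I`; the first coordinate is the projection `P(I) → I`, with kernel
`I Ω`. -/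
def principalParts {r : ℕ} (δ : Fin r → Derivation k K K) (I : Submodule A K) :
    Submodule A (Fin (r + 1) → K) :=
  Submodule.span A (jet δ '' (I : Set K))

/-- `F(I) = ⋀ʳ⁺¹ P(I) / torsion`. -/
def F {r : ℕ} (δ : Fin r → Derivation k K K) (I : Submodule A K) : Submodule A K :=
  topExterior (principalParts δ I)

/-- `J₀ = I`, `Jᵢ₊₁ = Jᵢ F(Jᵢ)`; with `Lᵢ = F(Jᵢ)` this is `Jᵢ = I L₀ ⋯ Lᵢ₋₁`. -/
def J {r : ℕ} (δ : Fin r → Derivation k K K) (I : Submodule A K) : ℕ → Submodule A K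
  | 0 => I
  | i + 1 => J δ I i * F δ (J δ I i)

/-- `Lᵢ = F(Jᵢ)`. -/
def L {r : ℕ} (δ : Fin r → Derivation k K K) (I : Submodule A K) (i : ℕ) : Submodule A K :=
  F δ (J δ I i)

/-- `∏ⱼ Mⱼ ^ aⱼ`, where `i = ∑ⱼ aⱼ bʲ` with `0 ≤ aⱼ < b` is the expansion of `i` to the base `b`
(the digits `aⱼ` with `j > i` vanish for `b ≥ 2`). -/
def expansionProd (b : ℕ) (M : ℕ → Submodule A K) (i : ℕ) : Submodule A K :=
  ∏ j ∈ Finset.range (i + 1), M j ^ (i / b ^ j % b)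

/-- The degree `i` part `Rᵢ = L₀ ^ a₀ L₁ ^ a₁ ⋯`, from the base `r + 2` expansion of `i`. -/
def gradedPart {r : ℕ} (δ : Fin r → Derivation k K K) (I : Submodule A K) (i : ℕ) :
    Submodule A K :=
  expansionProd (r + 2) (L δ I) i

/-! ### The natural map `F(I)ʳ⁺² → F(I F(I))` and the multiplication of `R` -/

lemma topExterior_span {n : ℕ} (S : Set (Fin n → K)) :
    topExterior (Submodule.span A S) =
      Submodule.span A {d | ∃ p : Fin n → Fin n → K, (∀ i, p i ∈ S) ∧ d = (Matrix.of p).det} := by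
  rw [topExterior, LinearMap.range_eq_map,
    ← exteriorPower.ιMulti_span_of_span A n _ (Submodule.span_span_coe_preimage (s := S)),
    Submodule.map_span]
  congr 1
  ext d
  constructor
  · rintro ⟨_, ⟨a, ha, rfl⟩, rfl⟩
    refine ⟨fun i => a i, fun i => ha ⟨i, rfl⟩, ?_⟩
    rw [exteriorPower.alternatingMapLinearEquiv_apply_ιMulti]
    rfl
  · rintro ⟨p, hp, rfl⟩
    refine ⟨_, ⟨fun i => ⟨p i, Submodule.subset_span (hp i)⟩, ?_, rfl⟩, ?_⟩
    · rintro _ ⟨i, rfl⟩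
      exact hp i
    · rw [exteriorPower.alternatingMapLinearEquiv_apply_ιMulti]
      rfl

lemma det_jet_mul {r : ℕ} (δ : Fin r → Derivation k K K) (h : K) (f : Fin (r + 1) → K) :
    (Matrix.of fun i => jet δ (h * f i)).det =
      h ^ (r + 1) * (Matrix.of fun i => jet δ (f i)).det := by
  let M : Matrix (Fin (r + 1)) (Fin (r + 1)) K :=
    Matrix.of (Fin.cons (jet δ h) fun i => Pi.single i.succ h)
  have hM : M.det = h ^ (r + 1) := by
    rw [Matrix.det_of_isUpperTriangular]
    · rw [Fin.prod_univ_succ]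
      simp [M, jet, pow_succ']
    · intro i j hij
      refine Fin.cases (fun h => absurd h (by simp)) (fun i hij => ?_) i hij
      have : j ≠ i.succ := ne_of_lt hij
      simp [M, this]
  have : (Matrix.of fun i => jet δ (h * f i)) = (Matrix.of fun i => jet δ (f i)) * M := by
    ext i j
    rw [Matrix.mul_apply, Fin.sum_univ_succ]
    refine Fin.cases ?_ (fun j => ?_) j
    · simp [M, jet, mul_comm]
    · simp [M, jet, Pi.single_apply, Derivation.leibniz]
      ring
  rw [this, Matrix.det_mul, hM, mul_comm]

lemma pow_mem_F {r : ℕ} (δ : Fin r → Derivation k K K) (I : Submodule A K) {h : K}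
    (hh : h ∈ F δ I) : h ^ (r + 2) ∈ F δ (I * F δ I) := by
  suffices H : ∀ y ∈ F δ I, h ^ (r + 1) * y ∈ F δ (I * F δ I) by
    simpa [pow_succ] using H h hh
  intro y hy
  rw [F, principalParts, topExterior_span] at hy
  induction hy using Submodule.span_induction with
  | mem y hy =>
    obtain ⟨p, hp, rfl⟩ := hy
    choose f hf hfp using hp
    obtain rfl : (fun i => jet δ (f i)) = p := funext hfp
    rw [← det_jet_mul, F, principalParts, topExterior_span]
    refine Submodule.subset_span ⟨_, fun i => ⟨h * f i, ?_, rfl⟩, rfl⟩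
    rw [mul_comm h]
    exact Submodule.mul_mem_mul (hf i) hh
  | zero => simp
  | add y z _ _ hy hz => rw [mul_add]; exact add_mem hy hz
  | smul a y _ hy => rw [mul_smul_comm]; exact Submodule.smul_mem _ _ hy

/-- The coefficients of a polynomial whose values at the natural numbers lie in a subspace lie in
that subspace. -/
lemma coeff_mem_of_eval_mem [CharZero k] (N : Submodule k K) (n : ℕ) (c : ℕ → K)
    (hc : ∀ t : ℕ, ∑ j ∈ Finset.range n, (t : K) ^ j * c j ∈ N) : ∀ j < n, c j ∈ N := by
  intro j hj
  let W : Matrix (Fin n) (Fin n) k := Matrix.vandermonde fun i => ((i : ℕ) : k)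
  have hW : IsUnit W.det := by
    rw [isUnit_iff_ne_zero, Matrix.det_vandermonde_ne_zero_iff]
    intro a b hab
    exact Fin.ext (Nat.cast_injective hab)
  have key : c j = ∑ i : Fin n, W⁻¹ ⟨j, hj⟩ i •
      ∑ l ∈ Finset.range n, ((i : ℕ) : K) ^ l * c l := by
    have h1 : ∀ i : Fin n, ∑ l ∈ Finset.range n, ((i : ℕ) : K) ^ l * c l =
        ∑ l : Fin n, W i l • c l := by
      intro i
      rw [Finset.sum_range]
      refine Finset.sum_congr rfl fun l _ => ?_
      simp [W, Matrix.vandermonde_apply, Algebra.smul_def]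
    simp_rw [h1, Finset.smul_sum, smul_smul]
    rw [Finset.sum_comm]
    simp_rw [← Finset.sum_smul, ← Matrix.mul_apply, Matrix.nonsing_inv_mul W hW]
    simp [Matrix.one_apply]
  rw [key]
  exact Submodule.sum_mem _ fun i _ => Submodule.smul_mem _ _ (hc i)

/-- Polarization: in characteristic zero the `n`-th powers of the elements of `M` span `M ^ n`. -/
lemma pow_le_of_pow_mem [CharZero k] [Algebra k A] [IsScalarTower k A K] (M N : Submodule A K)
    (n : ℕ) (h : ∀ x ∈ M, x ^ n ∈ N) : M ^ n ≤ N := by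
  have key : ∀ m ≤ n, ∀ y ∈ M ^ m, ∀ x ∈ M, x ^ (n - m) * y ∈ N := by
    intro m
    induction m with
    | zero =>
      intro _ y hy x hx
      rw [pow_zero, Submodule.mem_one] at hy
      obtain ⟨a, rfl⟩ := hy
      rw [mul_comm, ← Algebra.smul_def]
      exact N.smul_mem a (h x hx)
    | succ m ih =>
      intro hm y hy x hx
      rw [pow_succ] at hy
      induction hy using Submodule.mul_induction_on' with
      | add y _ z _ hy hz => rw [mul_add]; exact add_mem hy hz
      | mem_mul_mem y hy z hz =>
        have := coeff_mem_of_eval_mem (N.restrictScalars k) (n - m + 1)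
          (fun j => z ^ j * x ^ (n - m - j) * ((n - m).choose j : K) * y) (fun t => ?_) 1 (by omega)
        · have hne : ((n - m : ℕ) : k) ≠ 0 := by
            rw [Nat.cast_ne_zero]; omega
          have h2 := (N.restrictScalars k).smul_mem ((n - m : ℕ) : k)⁻¹ this
          have e : n - (m + 1) = n - m - 1 := by omega
          have h3 : ((n - m : ℕ) : k)⁻¹ • (z ^ 1 * x ^ (n - m - 1) *
              ((n - m).choose 1 : K) * y) = x ^ (n - (m + 1)) * (y * z) := by
            rw [inv_smul_eq_iff₀ hne, Algebra.smul_def, map_natCast, e, Nat.choose_one_right]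
            ring
          rw [h3] at h2
          exact h2
        · have := ih (by omega) y hy ((t : ℕ) • z + x) (add_mem (nsmul_mem hz t) hx)
          rw [add_pow, Finset.sum_mul] at this
          have e : (∑ j ∈ Finset.range (n - m + 1), (t : K) ^ j *
              (z ^ j * x ^ (n - m - j) * ((n - m).choose j : K) * y)) =
              ∑ j ∈ Finset.range (n - m + 1), (t • z) ^ j * x ^ (n - m - j) *
                ((n - m).choose j : K) * y := by
            refine Finset.sum_congr rfl fun j _ => ?_
            rw [nsmul_eq_mul]
            ring
          rw [e]
          exact this
  intro y hy
  simpa using key n le_rfl y hy 0 M.zero_mem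

lemma F_pow_le [CharZero k] [Algebra k A] [IsScalarTower k A K] {r : ℕ}
    (δ : Fin r → Derivation k K K) (I : Submodule A K) :
    F δ I ^ (r + 2) ≤ F δ (I * F δ I) :=
  pow_le_of_pow_mem (k := k) _ _ _ fun _ hx => pow_mem_F δ I hx

/-- The natural map `F(I)ʳ⁺² → F(I F(I))`. -/
def naturalMap [CharZero k] [Algebra k A] [IsScalarTower k A K] {r : ℕ}
    (δ : Fin r → Derivation k K K) (I : Submodule A K) :
    ↥(F δ I ^ (r + 2)) →ₗ[A] ↥(F δ (I * F δ I)) :=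
  Submodule.inclusion (F_pow_le δ I)

lemma expansionProd_zero {b : ℕ} (M : ℕ → Submodule A K) :
    expansionProd b M 0 = 1 := by
  simp [expansionProd]

lemma expansionProd_eq {b : ℕ} (hb : 2 ≤ b) (M : ℕ → Submodule A K) (i N : ℕ) (hN : i < N) :
    expansionProd b M i = ∏ j ∈ Finset.range N, M j ^ (i / b ^ j % b) := by
  refine Finset.prod_subset (by simpa using hN) fun j _ hj => ?_
  have hj : i < j := by simpa using hj
  rw [Nat.div_eq_of_lt (hj.trans (Nat.lt_pow_self (by omega))), Nat.zero_mod, pow_zero]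

lemma expansionProd_step {b : ℕ} (hb : 2 ≤ b) (M : ℕ → Submodule A K) (i : ℕ) :
    expansionProd b M i = M 0 ^ (i % b) * expansionProd b (fun j => M (j + 1)) (i / b) := by
  rw [expansionProd, Finset.prod_range_succ', mul_comm]
  congr 1
  · simp
  · rcases Nat.eq_zero_or_pos i with rfl | hi
    · simp [expansionProd]
    · rw [expansionProd_eq hb _ (i / b) i (Nat.div_lt_self hi (by omega))]
      refine Finset.prod_congr rfl fun j _ => ?_
      rw [pow_succ', Nat.div_div_eq_div_mul]

/-- Carrying: if `M j ^ b ≤ M (j + 1)` then the products attached to the base `b` expansions form a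
multiplicative filtration. -/
lemma expansionProd_mul_le {b : ℕ} (hb : 2 ≤ b) (n : ℕ) : ∀ (M : ℕ → Submodule A K)
    (_ : ∀ j, M j ^ b ≤ M (j + 1)) (i j : ℕ) (_ : i + j = n),
    expansionProd b M i * expansionProd b M j ≤ expansionProd b M (i + j) := by
  induction n using Nat.strong_induction_on with
  | _ n ih =>
    intro M hM i j hij
    rcases Nat.eq_zero_or_pos i with rfl | hi
    · simp [expansionProd_zero]
    rcases Nat.eq_zero_or_pos j with rfl | hj
    · simp [expansionProd_zero]
    have hM' : ∀ j, (fun j => M (j + 1)) j ^ b ≤ (fun j => M (j + 1)) (j + 1) := fun j => hM (j + 1)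
    have hid := Nat.div_lt_self hi (show 1 < b by omega)
    have hjd := Nat.div_lt_self hj (show 1 < b by omega)
    have h1 := ih (i / b + j / b) (by omega) _ hM' (i / b) (j / b) rfl
    rw [expansionProd_step hb M i, expansionProd_step hb M j, expansionProd_step hb M (i + j),
      mul_mul_mul_comm, ← pow_add]
    rcases lt_or_ge (i % b + j % b) b with hlt | hge
    · rw [Nat.add_mod, Nat.mod_eq_of_lt hlt, Nat.add_div (by omega), if_neg (by omega), add_zero]
      exact mul_le_mul' le_rfl h1
    · have e1 : (i + j) % b = i % b + j % b - b := by
        rw [Nat.add_mod, Nat.mod_eq_sub_mod hge, Nat.mod_eq_of_lt]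
        have := Nat.mod_lt i (show 0 < b by omega)
        have := Nat.mod_lt j (show 0 < b by omega)
        omega
      have e2 : (i + j) / b = 1 + (i / b + j / b) := by
        rw [Nat.add_div (by omega), if_pos hge]; omega
      have e3 : i % b + j % b = (i % b + j % b - b) + b := by omega
      have h2 := ih (1 + (i / b + j / b)) (by omega) _ hM' 1 (i / b + j / b) rfl
      have h3 : expansionProd b (fun j => M (j + 1)) 1 = M 1 := by
        rw [expansionProd_step hb, Nat.mod_eq_of_lt (by omega), Nat.div_eq_of_lt (by omega),
          expansionProd_zero, pow_one, mul_one]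
      rw [h3] at h2
      rw [e1, e2, e3, pow_add, Nat.add_sub_cancel, mul_assoc]
      exact mul_le_mul' le_rfl
        ((mul_le_mul' (hM 0) h1).trans h2)

lemma gradedPart_mul_le [CharZero k] [Algebra k A] [IsScalarTower k A K] {r : ℕ}
    (δ : Fin r → Derivation k K K) (I : Submodule A K) (i j : ℕ) :
    gradedPart δ I i * gradedPart δ I j ≤ gradedPart δ I (i + j) :=
  expansionProd_mul_le (by omega) _ _ (fun j => F_pow_le (k := k) δ (J δ I j)) i j rfl

/-- The graded algebra `R(I) = ⨁ Rᵢ`, as a subalgebra of `K[T]`. -/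
def R [CharZero k] [Algebra k A] [IsScalarTower k A K] {r : ℕ}
    (δ : Fin r → Derivation k K K) (I : Submodule A K) : Subalgebra A K[X] where
  carrier := {f | ∀ i, f.coeff i ∈ gradedPart δ I i}
  mul_mem' {f g} hf hg i := by
    rw [coeff_mul]
    refine Submodule.sum_mem _ fun x hx => ?_
    rw [← Finset.HasAntidiagonal.mem_antidiagonal.mp hx]
    exact gradedPart_mul_le δ I _ _ (Submodule.mul_mem_mul (hf _) (hg _))
  add_mem' {f g} hf hg i := by
    rw [coeff_add]
    exact add_mem (hf i) (hg i)
  algebraMap_mem' a i := by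
    rw [Polynomial.algebraMap_apply, coeff_C]
    split_ifs with h
    · subst h
      rw [gradedPart, expansionProd_zero]
      exact Submodule.algebraMap_mem a
    · exact zero_mem _

/-! ### Blowups

A birational model of `K` (an integral separated scheme with function field `K`) is represented by
the set of its local rings, as local subrings of `K`; this set determines the model, and a
birational morphism of models `W' → W` is an isomorphism if and only if `W'` and `W` have the same
local rings. -/

/-- The affine chart `A[M / g] ⊆ K` of the blowup of `Spec A` along a fractional ideal `M`. -/
def blowupChart (M : Submodule A K) (g : K) : Subring K :=
  (Algebra.adjoin A {y | ∃ m ∈ M, y = m / g}).toSubring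

/-- The local rings of the blowup `Proj (⨁ Mⁿ)` of `Spec A` along a fractional ideal `M`. -/
def blowup (M : Submodule A K) : Set (LocalSubring K) :=
  {O | ∃ g ∈ M, g ≠ 0 ∧ ∃ (P : Ideal (blowupChart M g)) (_ : P.IsPrime),
    O = LocalSubring.ofPrime (blowupChart M g) P}

/-- The Gauss blowup of a model along the foliation: the blowup along its canonical sheaf
`⋀ʳ Ω / torsion`, that is, the closure of the graph of the Gauss map, in its Plücker coordinates. -/
def gaussBlowup {r : ℕ} (δ : Fin r → Derivation k K K) (W : Set (LocalSubring K)) :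
    Set (LocalSubring K) :=
  ⋃ O ∈ W, blowup (canonical δ O.toSubring)

end Local

/-! ### Global objects on a variety -/

section Global

variable {k : Type u} [Field k] {V : Scheme.{u}} [V.Over (Spec (CommRingCat.of k))] [IsIntegral V]

/-- The sections of an ideal sheaf on a non-empty affine open, as a submodule of the function
field. -/
def sections (I : V.IdealSheafData) (U : V.affineOpens) [Nonempty U.1] :
    Submodule Γ(V, U) V.functionField :=
  Submodule.map (Algebra.linearMap Γ(V, U) V.functionField) (I.ideal U)

/-- The blowup of `V` along an ideal sheaf. -/
def idealBlowup (I : V.IdealSheafData) : Set (LocalSubring V.functionField) :=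
  ⋃ (U : V.affineOpens) (_ : Nonempty U.1), blowup (sections I U)

/-- The tower `⋯ → V₁ → V₀`: the blowup along `I`, followed by the Gauss process. -/
def tower {r : ℕ} (δ : Fin r → Derivation k V.functionField V.functionField)
    (I : V.IdealSheafData) : ℕ → Set (LocalSubring V.functionField)
  | 0 => idealBlowup I
  | n + 1 => gaussBlowup δ (tower δ I n)

end Global

end

end GaussProcess

/-!
Write `b = r + 2`, and let `M ↦ M B` be the extension of an `A`-submodule `M ⊆ K` to a larger ring
`B` (`extend`).

The jet is a differential operator of order one: `jet (x y f)` is the combination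
`x jet (y f) + y jet (x f) - x y jet f`. Hence the multipliers of `f` whose jets stay in a given
module form a ring closed under inverses (`jetSubring`), so that `F` commutes with localization, and
also with the extension to a local ring `O` of the blowup along `M`, where `M O = g O` and every
element of `M` is a multiple of `g`. As `F(g O) = gʳ⁺¹ ⋀ʳ Ω`, on the blowup along `M` one has
`F(M) = Mʳ⁺¹ ⋀ʳ Ω` (`extend_F_of_mem_blowup`). The local rings of the blowup along `M` are the
minimal ones, for domination, among those on which `M` becomes principal (`mem_blowup_iff`), and a
product is principal over a local ring if and only if its factors are. Therefore the Gauss blowup of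
the blowup along `M` is the blowup along `M F(M)`, and the `n`-th stage of the tower is the blowup
along `Jₙ` (`tower_eq`).

* (3) implies (2): if `Lₜᵇ = Lₜ₊₁` then `Jₜ₊₂ = Jₜ Lₜ Lₜᵇ` and `Jₜ₊₁ = Jₜ Lₜ` have the same blowup.
* (2) implies (1): from the stage `N` at which the tower stops, a valuation ring containing the
  coordinate ring of an affine open `U` has the same center `O` on all stages. By separatedness `O`
  lies over `U`, so that `Lₙ = Jₙʳ⁺¹ ⋀ʳ Ω` over `O` for all `n ≥ N`. With `Jₙ₊₁ = Jₙ Lₙ` this gives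
  `Lₙ₊₁ = Lₙᵇ` over `O`. By the valuative criterion the Veronese subalgebra of `R(I)` of degrees
  divisible by `bᴺ` is integral over the Rees algebra of `L_N`, hence finitely generated by Noether
  normalization and separability, and `R(I)` is finitely generated over it
  (`expansionAlgebra_finiteType`, `expansionAlgebra_fg_of_add`).
* (1) implies (3): a product of homogeneous elements of `R(I)` of positive degrees with sum `bᵗ⁺¹`
  lies in `Lₜᵇ`, as the inclusion `Lₜᵇ ⊆ Lₜ₊₁` is not used before the last carry. So if there are no
  generators in degrees `≥ bᵗ⁺¹`, then `Lₜ₊₁ = Lₜᵇ` (`exists_pow_eq_of_finiteType`). A common `t`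
  exists by quasi-compactness.
-/

namespace GaussProcess

/-! ### Extension of scalars for submodules of `K` -/

section Extension

variable {K : Type*} [Field K]
variable {A : Type*} [CommRing A] [Algebra A K] {B : Type*} [CommRing B] [Algebra B K]
variable {C : Type*} [CommRing C] [Algebra C K]

/-- The extension `M B ⊆ K` of an `A`-submodule `M ⊆ K` to a ring `B` mapping to `K`. It is defined
for all `A` and `B`; it is meaningful when the image of `A` in `K` lies in that of `B`. -/
def extend (B : Type*) [CommRing B] [Algebra B K] (M : Submodule A K) : Submodule B K :=
  Submodule.span B (M : Set K)

lemma subset_extend (M : Submodule A K) {x : K} (hx : x ∈ M) : x ∈ extend B M :=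
  Submodule.subset_span hx

lemma extend_le {M : Submodule A K} {N : Submodule B K} : extend B M ≤ N ↔ ∀ x ∈ M, x ∈ N :=
  Submodule.span_le

lemma span_span_of_range_le (h : (algebraMap A K).range ≤ (algebraMap B K).range)
    (S : Set K) : Submodule.span B (Submodule.span A S : Set K) = Submodule.span B S := by
  refine le_antisymm (Submodule.span_le.mpr fun x hx => ?_)
    (Submodule.span_mono Submodule.subset_span)
  induction hx using Submodule.span_induction with
  | mem x hx => exact Submodule.subset_span hx
  | zero => exact zero_mem _
  | add x y _ _ hx hy => exact add_mem hx hy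
  | smul a x _ hx =>
    obtain ⟨b, hb⟩ := h ⟨a, rfl⟩
    have : a • x = b • x := by
      rw [← algebraMap_smul K a x, ← algebraMap_smul K b x, hb]
    simp only [SetLike.mem_coe, this]
    exact Submodule.smul_mem _ _ hx

lemma extend_span (h : (algebraMap A K).range ≤ (algebraMap B K).range) (S : Set K) :
    extend B (Submodule.span A S) = Submodule.span B S :=
  span_span_of_range_le h S

lemma extend_extend (h : (algebraMap B K).range ≤ (algebraMap C K).range) (M : Submodule A K) :
    extend C (extend B M) = extend C M :=
  span_span_of_range_le h _

lemma extend_mul (h : (algebraMap A K).range ≤ (algebraMap B K).range) (M N : Submodule A K) :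
    extend B (M * N) = extend B M * extend B N := by
  rw [Submodule.mul_eq_span_mul_set, extend_span h, extend, extend, Submodule.span_mul_span]

lemma extend_one (h : (algebraMap A K).range ≤ (algebraMap B K).range) :
    extend B (1 : Submodule A K) = 1 := by
  rw [Submodule.one_eq_span, extend_span h, Submodule.one_eq_span]

lemma extend_pow (h : (algebraMap A K).range ≤ (algebraMap B K).range) (M : Submodule A K)
    (n : ℕ) : extend B (M ^ n) = extend B M ^ n := by
  induction n with
  | zero => rw [pow_zero, pow_zero, extend_one h]
  | succ n ih => rw [pow_succ, pow_succ, extend_mul h, ih]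

end Extension

/-! ### Jets and principal parts -/

section Jets

variable {k : Type*} {K : Type u} [Field k] [Field K] [Algebra k K]
variable {A : Type*} [CommRing A] [Algebra A K] {B : Type*} [CommRing B] [Algebra B K]
variable {r : ℕ} (δ : Fin r → Derivation k K K)

lemma jet_zero : jet δ 0 = 0 := by
  ext i
  refine Fin.cases ?_ (fun i => ?_) i <;> simp [jet]

lemma jet_add (x y : K) : jet δ (x + y) = jet δ x + jet δ y := by
  ext i
  refine Fin.cases ?_ (fun i => ?_) i <;> simp [jet]

lemma jet_neg (x : K) : jet δ (-x) = -jet δ x := by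
  ext i
  refine Fin.cases ?_ (fun i => ?_) i <;> simp [jet]

/-- The jet is a differential operator of order one. -/
lemma jet_mul_mul (x y f : K) :
    jet δ (x * y * f) = x • jet δ (y * f) + y • jet δ (x * f) - (x * y) • jet δ f := by
  ext i
  refine Fin.cases ?_ (fun i => ?_) i
  · simp [jet]; ring
  · simp [jet, Derivation.leibniz]; ring

lemma jet_scalar_mul (c : k) (f : K) :
    jet δ (algebraMap k K c * f) = algebraMap k K c • jet δ f := by
  ext i
  refine Fin.cases ?_ (fun i => ?_) i <;> simp [jet, Derivation.leibniz]

lemma smul_mem_of_mem_range {P : Submodule B (Fin (r + 1) → K)} {x : K}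
    (hx : x ∈ (algebraMap B K).range) {v : Fin (r + 1) → K} (hv : v ∈ P) : x • v ∈ P := by
  obtain ⟨b, rfl⟩ := hx
  rw [algebraMap_smul]
  exact P.smul_mem b hv

/-- Since the jet is a differential operator of order one, the multipliers of `f` whose jets stay in
a given module form a ring. -/
def jetSubring (P : Submodule B (Fin (r + 1) → K)) (f : K) (hf : jet δ f ∈ P) : Subring K where
  carrier := {x | x ∈ (algebraMap B K).range ∧ jet δ (x * f) ∈ P}
  mul_mem' {x y} hx hy := by
    refine ⟨mul_mem hx.1 hy.1, ?_⟩
    rw [jet_mul_mul]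
    exact sub_mem (add_mem (smul_mem_of_mem_range hx.1 hy.2) (smul_mem_of_mem_range hy.1 hx.2))
      (smul_mem_of_mem_range (mul_mem hx.1 hy.1) hf)
  one_mem' := ⟨one_mem _, by rwa [one_mul]⟩
  add_mem' {x y} hx hy := by
    refine ⟨add_mem hx.1 hy.1, ?_⟩
    rw [add_mul, jet_add]
    exact add_mem hx.2 hy.2
  zero_mem' := ⟨zero_mem _, by rw [zero_mul, jet_zero]; exact zero_mem _⟩
  neg_mem' {x} hx := by
    refine ⟨neg_mem hx.1, ?_⟩
    rw [neg_mul, jet_neg]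
    exact neg_mem hx.2

/-- The quotient rule for jets. -/
lemma inv_mem_jetSubring {P : Submodule B (Fin (r + 1) → K)} {f : K} (hf : jet δ f ∈ P) {x : K}
    (hx : x ∈ jetSubring δ P f hf) (hx' : x⁻¹ ∈ (algebraMap B K).range) :
    x⁻¹ ∈ jetSubring δ P f hf := by
  refine ⟨hx', ?_⟩
  rcases eq_or_ne x 0 with rfl | h0
  · rw [inv_zero, zero_mul, jet_zero]
    exact zero_mem _
  have h := jet_mul_mul δ x⁻¹ x f
  rw [inv_mul_cancel₀ h0, one_mul, one_smul] at h
  have h' : jet δ (x⁻¹ * f) = x⁻¹ • (jet δ f + jet δ f - x⁻¹ • jet δ (x * f)) := by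
    rw [eq_inv_smul_iff₀ h0, eq_sub_iff_add_eq]
    rw [eq_sub_iff_add_eq] at h
    rw [h]
    exact add_comm _ _
  rw [h']
  exact smul_mem_of_mem_range hx' (sub_mem (add_mem hf hf) (smul_mem_of_mem_range hx' hx.2))

lemma extend_topExterior_span (h : (algebraMap A K).range ≤ (algebraMap B K).range) {n : ℕ}
    (S : Set (Fin n → K)) :
    extend B (topExterior (Submodule.span A S)) = topExterior (Submodule.span B S) := by
  rw [topExterior_span, extend_span h, topExterior_span]

/-- Formation of `F` commutes with an extension of rings as soon as no new jets appear. -/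
lemma F_extend (h : (algebraMap A K).range ≤ (algebraMap B K).range) (M : Submodule A K)
    (hM : ∀ b : B, ∀ f ∈ M,
      jet δ (algebraMap B K b * f) ∈ Submodule.span B (jet δ '' (M : Set K))) :
    F δ (extend B M) = extend B (F δ M) := by
  have : principalParts δ (extend B M) = Submodule.span B (jet δ '' (M : Set K)) := by
    refine le_antisymm (Submodule.span_le.mpr ?_)
      (Submodule.span_mono (Set.image_mono Submodule.subset_span))
    rintro _ ⟨f, hf, rfl⟩
    suffices H : ∀ b : B, jet δ (algebraMap B K b * f) ∈ Submodule.span B (jet δ '' (M : Set K)) by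
      simpa using H 1
    induction hf using Submodule.span_induction with
    | mem f hf => exact fun b => hM b f hf
    | zero => intro b; rw [mul_zero, jet_zero]; exact zero_mem _
    | add x y _ _ hx hy => intro b; rw [mul_add, jet_add]; exact add_mem (hx b) (hy b)
    | smul c x _ hx =>
      intro b
      rw [Algebra.smul_def, ← mul_assoc, ← map_mul]
      exact hx _
  rw [F, this, F, principalParts, extend_topExterior_span h]

lemma F_eq_span (M : Submodule A K) :
    F δ M = Submodule.span A {d | ∃ f : Fin (r + 1) → K, (∀ i, f i ∈ M) ∧
      d = (Matrix.of fun i => jet δ (f i)).det} := by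
  rw [F, principalParts, topExterior_span]
  congr 1
  ext d
  constructor
  · rintro ⟨p, hp, rfl⟩
    choose f hf hfp using hp
    exact ⟨f, hf, by rw [funext hfp]⟩
  · rintro ⟨f, hf, rfl⟩
    exact ⟨_, fun i => ⟨f i, hf i, rfl⟩, rfl⟩

lemma canonical_eq_span (A : Type*) [CommRing A] [Algebra A K] :
    canonical δ A = Submodule.span A {d | ∃ a : Fin r → A,
      d = (Matrix.of fun i j => δ j (algebraMap A K (a i))).det} := by
  rw [canonical, differentials, topExterior_span]
  congr 1
  ext d
  constructor
  · rintro ⟨p, hp, rfl⟩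
    choose a ha using hp
    exact ⟨a, by rw [← funext ha]⟩
  · rintro ⟨a, rfl⟩
    exact ⟨_, fun i => ⟨a i, rfl⟩, rfl⟩

lemma F_one : F δ (1 : Submodule A K) = canonical δ A := by
  rw [F_eq_span, canonical_eq_span]
  apply le_antisymm <;> rw [Submodule.span_le]
  · rintro _ ⟨f, hf, rfl⟩
    simp only [Submodule.mem_one] at hf
    choose a ha using hf
    -- Expand along the column of values; the minors are determinants of differentials.
    rw [SetLike.mem_coe, Matrix.det_succ_column_zero]
    refine Submodule.sum_mem _ fun i _ => ?_
    have : (-1 : K) ^ (i : ℕ) * (Matrix.of fun i => jet δ (f i)) i 0 =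
        algebraMap A K ((-1) ^ (i : ℕ) * a i) := by
      simp [jet, ha]
    rw [this, ← Algebra.smul_def]
    refine Submodule.smul_mem _ _ (Submodule.subset_span ⟨fun j => a (i.succAbove j), ?_⟩)
    congr 1
    ext p q
    simp [jet, ha]
  · rintro _ ⟨a, rfl⟩
    -- The jet of `1` is `(1, 0, …, 0)`.
    refine Submodule.subset_span ⟨Fin.cons 1 fun i => algebraMap A K (a i), ?_, ?_⟩
    · intro i
      refine Fin.cases ?_ (fun i => ?_) i
      · exact Submodule.one_le.mp le_rfl
      · exact Submodule.algebraMap_mem _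
    · rw [Matrix.det_succ_row_zero, Fin.sum_univ_succ]
      simp only [Matrix.of_apply, Fin.cons_zero, jet, Fin.cons_succ, Derivation.map_one_eq_zero,
        mul_zero, zero_mul, Finset.sum_const_zero, add_zero, Fin.val_zero, pow_zero, one_mul]
      rfl

lemma F_span_singleton_mul (g : K) (M : Submodule A K) :
    F δ (Submodule.span A {g} * M) = Submodule.span A {g} ^ (r + 1) * F δ M := by
  rw [F_eq_span, F_eq_span, Submodule.span_pow, Submodule.span_mul_span, Set.singleton_pow]
  congr 1
  ext d
  rw [Set.singleton_mul, Set.mem_image]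
  constructor
  · rintro ⟨f, hf, rfl⟩
    choose m hm hmf using fun i => Submodule.mem_span_singleton_mul.mp (hf i)
    obtain rfl : (fun i => g * m i) = f := funext hmf
    exact ⟨_, ⟨m, hm, rfl⟩, (det_jet_mul δ g m).symm⟩
  · rintro ⟨_, ⟨m, hm, rfl⟩, rfl⟩
    exact ⟨fun i => g * m i, fun i => Submodule.mem_span_singleton_mul.mpr ⟨m i, hm i, rfl⟩,
      (det_jet_mul δ g m).symm⟩

/-- For a principal module `M`, `F(M) = Mʳ⁺¹ ⋀ʳ Ω`. -/
lemma F_span_singleton (g : K) :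
    F δ (Submodule.span A {g}) = Submodule.span A {g} ^ (r + 1) * canonical δ A := by
  rw [← F_one, ← F_span_singleton_mul, mul_one]

/-- If `fᵢ` generate `M` and `xⱼ` generate the `k`-algebra `A`, then the jets of the `fᵢ` and of the
`xⱼ fᵢ` generate the principal parts of `M`: for fixed `i` the good multipliers of `fᵢ` form a
ring. -/
lemma F_fg [Algebra k A] [IsScalarTower k A K] [Algebra.FiniteType k A] {M : Submodule A K}
    (hM : M.FG) : (F δ M).FG := by
  obtain ⟨S, rfl⟩ := hM
  obtain ⟨T, hT⟩ := (inferInstance : Algebra.FiniteType k A).out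
  classical
  let T' : Finset A := insert 1 T
  let S' : Finset K := Finset.image (fun p : A × K => algebraMap A K p.1 * p.2) (T' ×ˢ S)
  have key : principalParts δ (Submodule.span A (S : Set K)) =
      Submodule.span A (jet δ '' (S' : Set K)) := by
    apply le_antisymm
    · rw [principalParts, Submodule.span_le]
      rintro _ ⟨f, hf, rfl⟩
      suffices H : ∀ a : A,
          jet δ (algebraMap A K a * f) ∈ Submodule.span A (jet δ '' (S' : Set K)) by
        simpa using H 1
      induction hf using Submodule.span_induction with
      | zero => intro b; rw [mul_zero, jet_zero]; exact zero_mem _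
      | add x y _ _ hx hy => intro b; rw [mul_add, jet_add]; exact add_mem (hx b) (hy b)
      | smul c x _ hx =>
        intro b
        rw [Algebra.smul_def, ← mul_assoc, ← map_mul]
        exact hx _
      | mem f hf =>
        have hm : ∀ t ∈ T', jet δ (algebraMap A K t * f) ∈
            Submodule.span A (jet δ '' (S' : Set K)) := fun t ht =>
          Submodule.subset_span ⟨_, Finset.mem_coe.mpr
            (Finset.mem_image.mpr ⟨(t, f), Finset.mem_product.mpr ⟨ht, hf⟩, rfl⟩), rfl⟩
        have h1 : jet δ f ∈ Submodule.span A (jet δ '' (S' : Set K)) := by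
          simpa using hm 1 (Finset.mem_insert_self _ _)
        intro a
        have ha : a ∈ Algebra.adjoin k (T : Set A) := hT ▸ Algebra.mem_top
        suffices algebraMap A K a ∈ jetSubring δ _ f h1 from this.2
        induction ha using Algebra.adjoin_induction with
        | mem a ha => exact ⟨⟨a, rfl⟩, hm a (Finset.mem_insert_of_mem ha)⟩
        | algebraMap c =>
          refine ⟨⟨_, rfl⟩, ?_⟩
          rw [← IsScalarTower.algebraMap_apply, jet_scalar_mul]
          rw [IsScalarTower.algebraMap_apply k A K]
          exact smul_mem_of_mem_range ⟨_, rfl⟩ h1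
        | add x y _ _ hx hy => rw [map_add]; exact add_mem hx hy
        | mul x y _ _ hx hy => rw [map_mul]; exact mul_mem hx hy
    · refine Submodule.span_mono (Set.image_mono fun x hx => ?_)
      obtain ⟨⟨t, s⟩, hp, rfl⟩ := Finset.mem_image.mp (Finset.mem_coe.mp hx)
      simp only [← Algebra.smul_def]
      exact Submodule.smul_mem _ _ (Submodule.subset_span (Finset.mem_product.mp hp).2)
  rw [F, key, topExterior_span]
  refine Submodule.fg_span ?_
  have hfin : (Set.univ.pi fun _ : Fin (r + 1) => jet δ '' (S' : Set K)).Finite :=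
    Set.Finite.pi fun _ => (Finset.finite_toSet S').image _
  refine (hfin.image fun p => (Matrix.of p).det).subset ?_
  rintro _ ⟨p, hp, rfl⟩
  exact ⟨p, fun i _ => hp i, rfl⟩

lemma derivation_eq_zero_of_isFractionRing [IsDomain A] [IsFractionRing A K]
    (D : Derivation k K K) (hD : ∀ a : A, D (algebraMap A K a) = 0) : D = 0 := by
  ext x
  obtain ⟨a, s, hs, rfl⟩ := IsFractionRing.div_surjective (A := A) x
  simp [Derivation.leibniz_div, hD]

/-- The jets of the elements of a nonzero `M` span `Kʳ⁺¹`: a linear form `φ` that vanishes on the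
jets of `f` and of all `a f` gives a combination of the `δᵢ` that vanishes on `A`, hence on `K`. -/
lemma span_jet_eq_top [IsDomain A] [IsFractionRing A K] (hδ : LinearIndependent K δ)
    {M : Submodule A K} (hM : M ≠ ⊥) : Submodule.span K (jet δ '' (M : Set K)) = ⊤ := by
  obtain ⟨f, hf, hf0⟩ := Submodule.exists_mem_ne_zero_of_ne_bot hM
  by_contra hne
  obtain ⟨φ, hφ, hle⟩ := Submodule.exists_le_ker_of_lt_top _ (lt_top_iff_ne_top.mpr hne)
  have hφ' : ∀ v, φ v =
      φ (Pi.single 0 1) * v 0 + ∑ i : Fin r, φ (Pi.single i.succ 1) * v i.succ := by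
    intro v
    rw [LinearMap.pi_apply_eq_sum_univ φ v, Fin.sum_univ_succ]
    simp only [smul_eq_mul]
    rw [mul_comm]
    congr 1
    · congr 2; ext j; simp [Pi.single_apply, eq_comm]
    · refine Finset.sum_congr rfl fun i _ => ?_
      rw [mul_comm]; congr 2; ext j; simp [Pi.single_apply, eq_comm]
  set c : Fin r → K := fun i => φ (Pi.single i.succ 1)
  have hφj : ∀ g ∈ M, φ (Pi.single 0 1) * g + ∑ i, c i * δ i g = 0 := by
    intro g hg
    have : φ (jet δ g) = 0 := hle (Submodule.subset_span ⟨g, hg, rfl⟩)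
    rw [hφ'] at this
    simpa [jet] using this
  have hD : ∑ i, c i • δ i = 0 := by
    refine derivation_eq_zero_of_isFractionRing (A := A) _ fun a => ?_
    have h1 := hφj _ (M.smul_mem a hf)
    have h2 := hφj f hf
    rw [Algebra.smul_def] at h1
    simp only [Derivation.leibniz, smul_eq_mul, mul_add, Finset.sum_add_distrib] at h1
    have e1 : ∑ i, c i * (algebraMap A K a * δ i f) = algebraMap A K a * ∑ i, c i * δ i f := by
      rw [Finset.mul_sum]; exact Finset.sum_congr rfl fun i _ => by ring
    have e2 : ∑ i, c i * (f * δ i (algebraMap A K a)) =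
        f * ∑ i, c i * δ i (algebraMap A K a) := by
      rw [Finset.mul_sum]; exact Finset.sum_congr rfl fun i _ => by ring
    rw [e1, e2] at h1
    have h3 : f * ∑ i, c i * δ i (algebraMap A K a) = 0 := by
      linear_combination h1 - algebraMap A K a * h2
    have h4 := (mul_eq_zero.mp h3).resolve_left hf0
    rw [← h4, ← Derivation.coeFnAddMonoidHom_apply, map_sum, Finset.sum_apply]
    rfl
  have hc : ∀ i, c i = 0 := Fintype.linearIndependent_iff.mp hδ c hD
  have h0 : φ (Pi.single 0 1) = 0 := by
    have := hφj f hf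
    simpa [hc, hf0] using this
  apply hφ
  refine LinearMap.ext fun v => ?_
  rw [hφ', h0]
  simp only [zero_mul, zero_add, LinearMap.zero_apply]
  exact Finset.sum_eq_zero fun i _ => by rw [show φ (Pi.single i.succ 1) = 0 from hc i, zero_mul]

lemma F_ne_bot [IsDomain A] [IsFractionRing A K] (hδ : LinearIndependent K δ)
    {M : Submodule A K} (hM : M ≠ ⊥) : F δ M ≠ ⊥ := by
  obtain ⟨s, hs, hspan, hli⟩ := exists_linearIndependent K (jet δ '' (M : Set K))
  rw [span_jet_eq_top δ hδ hM] at hspan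
  let e : Module.Basis s K (Fin (r + 1) → K) := Module.Basis.mk hli (by simp [hspan])
  let e' := e.indexEquiv (Pi.basisFun K (Fin (r + 1)))
  choose f hf hfj using fun i => hs (e'.symm i).2
  have hdet : (Matrix.of fun i => jet δ (f i)).det ≠ 0 := by
    rw [← isUnit_iff_ne_zero, ← Matrix.isUnit_iff_isUnit_det,
      ← Matrix.linearIndependent_rows_iff_isUnit]
    have : (Matrix.of fun i => jet δ (f i)).row = fun i => ((e'.symm i : s) : Fin (r + 1) → K) :=
      funext hfj
    rw [this]
    exact hli.comp _ e'.symm.injective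
  refine (Submodule.ne_bot_iff _).mpr ⟨_, ?_, hdet⟩
  rw [F_eq_span]
  exact Submodule.subset_span ⟨f, hf, rfl⟩

lemma J_ne_bot [IsDomain A] [IsFractionRing A K] (hδ : LinearIndependent K δ)
    {M : Submodule A K} (hM : M ≠ ⊥) (n : ℕ) : J δ M n ≠ ⊥ := by
  induction n with
  | zero => exact hM
  | succ n ih => exact mul_ne_zero ih (F_ne_bot δ hδ ih)

lemma J_fg [Algebra k A] [IsScalarTower k A K] [Algebra.FiniteType k A] {M : Submodule A K}
    (hM : M.FG) (n : ℕ) : (J δ M n).FG := by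
  induction n with
  | zero => exact hM
  | succ n ih => exact ih.mul (F_fg δ ih)

end Jets

/-! ### Localizations and domination -/

section LocalSubrings

variable {K : Type*} [Field K]

lemma inv_mem_of_le {O R : LocalSubring K} (h : O ≤ R) {x : K} (hx : x ∈ O.toSubring)
    (hx' : x⁻¹ ∈ R.toSubring) : x⁻¹ ∈ O.toSubring := by
  rcases eq_or_ne x 0 with rfl | h0
  · simp
  obtain ⟨h1, h2⟩ := h
  have hu : IsUnit (Subring.inclusion h1 ⟨x, hx⟩) :=
    IsUnit.of_mul_eq_one ⟨x⁻¹, hx'⟩ (Subtype.ext (mul_inv_cancel₀ h0))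
  obtain ⟨y, hy⟩ := (h2.map_nonunit _ hu).exists_right_inv
  have hy' : x * y = 1 := congrArg Subtype.val hy
  rw [inv_eq_of_mul_eq_one_right hy']
  exact y.2

lemma le_of_inv_mem {O R : LocalSubring K} (h : O.toSubring ≤ R.toSubring)
    (h' : ∀ x ∈ O.toSubring, x⁻¹ ∈ R.toSubring → x⁻¹ ∈ O.toSubring) : O ≤ R := by
  refine ⟨h, ⟨fun x hx => ?_⟩⟩
  obtain ⟨y, hy⟩ := hx.exists_right_inv
  have hy' : (x : K) * y = 1 := congrArg Subtype.val hy
  have := h' x x.2 (by rw [inv_eq_of_mul_eq_one_right hy']; exact y.2)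
  refine IsUnit.of_mul_eq_one ⟨(x : K)⁻¹, this⟩ (Subtype.ext (mul_inv_cancel₀ ?_))
  exact left_ne_zero_of_mul_eq_one hy'

lemma inv_mem_ofPrime {C : Subring K} {P : Ideal C} [P.IsPrime] {s : C} (hs : s ∉ P) :
    (s : K)⁻¹ ∈ (LocalSubring.ofPrime C P).toSubring := by
  have hu := (IsLocalization.AtPrime.isUnit_to_map_iff (LocalSubring.ofPrime C P).toSubring P s).mpr
    hs
  obtain ⟨y, hy⟩ := hu.exists_right_inv
  have hy' : (s : K) * y = 1 := congrArg Subtype.val hy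
  rw [inv_eq_of_mul_eq_one_right hy']
  exact y.2

lemma exists_of_mem_ofPrime {C : Subring K} {P : Ideal C} [P.IsPrime] {x : K}
    (hx : x ∈ (LocalSubring.ofPrime C P).toSubring) :
    ∃ a s : C, s ∉ P ∧ x = a * (s : K)⁻¹ := by
  obtain ⟨a, s, h⟩ := IsLocalization.exists_mk'_eq P.primeCompl
    (⟨x, hx⟩ : (LocalSubring.ofPrime C P).toSubring)
  refine ⟨a, s, s.2, ?_⟩
  rw [IsLocalization.mk'_eq_iff_eq_mul] at h
  have h' : (a : K) = x * (s : C) := congrArg Subtype.val h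
  have hs : ((s : C) : K) ≠ 0 := fun h0 => s.2 (by
    rw [show (s : C) = 0 from Subtype.ext h0]
    exact P.zero_mem)
  rw [h', mul_assoc, mul_inv_cancel₀ hs, mul_one]

/-- The localization of `C` at the prime below the maximal ideal of `O` is the least local subring
that contains `C` and is dominated by `O`. -/
lemma ofPrime_le_of_le {C : Subring K} {P : Ideal C} [P.IsPrime] {R : LocalSubring K}
    (hR : R ≤ LocalSubring.ofPrime C P) (hC : C ≤ R.toSubring) : LocalSubring.ofPrime C P ≤ R := by
  have h : (LocalSubring.ofPrime C P).toSubring ≤ R.toSubring := by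
    intro x hx
    obtain ⟨a, s, hs, rfl⟩ := exists_of_mem_ofPrime hx
    exact mul_mem (hC a.2) (inv_mem_of_le hR (hC s.2) (inv_mem_ofPrime hs))
  exact le_of_inv_mem h fun x _ hx' => hR.1 hx'

lemma exists_ofPrime_le {C : Subring K} {O : LocalSubring K} (h : C ≤ O.toSubring) :
    ∃ (P : Ideal C) (_ : P.IsPrime), LocalSubring.ofPrime C P ≤ O := by
  let P : Ideal C := (IsLocalRing.maximalIdeal O.toSubring).comap (Subring.inclusion h)
  have hs : ∀ s : C, s ∉ P → (s : K)⁻¹ ∈ O.toSubring := by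
    intro s hs
    obtain ⟨y, hy⟩ := (not_not.mp hs : IsUnit (Subring.inclusion h s)).exists_right_inv
    have hy' : (s : K) * y = 1 := congrArg Subtype.val hy
    rw [inv_eq_of_mul_eq_one_right hy']
    exact y.2
  refine ⟨P, inferInstance, le_of_inv_mem ?_ ?_⟩
  · intro x hx
    obtain ⟨a, s, hsP, rfl⟩ := exists_of_mem_ofPrime hx
    exact mul_mem (h a.2) (hs s hsP)
  · intro x hx hx'
    obtain ⟨a, s, hsP, rfl⟩ := exists_of_mem_ofPrime hx
    rcases eq_or_ne (a : K) 0 with h0 | h0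
    · simp [h0]
    have haP : a ∉ P := by
      intro ha
      refine ha (IsUnit.of_mul_eq_one ⟨(a : K)⁻¹, ?_⟩ (Subtype.ext (mul_inv_cancel₀ h0)))
      have hs0 : (s : K) ≠ 0 := fun e => hsP (by
        rw [show s = 0 from Subtype.ext e]
        exact P.zero_mem)
      have : (a : K)⁻¹ = (a * (s : K)⁻¹)⁻¹ * (s : K)⁻¹ := by field_simp
      rw [this]
      exact mul_mem hx' (hs s hsP)
    rw [mul_inv, inv_inv]
    exact mul_mem (inv_mem_ofPrime haP) (LocalSubring.le_ofPrime C P s.2)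

/-- In a local ring, if a sum is a unit then so is one of the summands. -/
lemma exists_inv_mem_of_sum_eq_one (O : LocalSubring K) {ι : Type*} (s : Finset ι) (f : ι → K)
    (hf : ∀ i ∈ s, f i ∈ O.toSubring) (h : ∑ i ∈ s, f i = 1) :
    ∃ i ∈ s, f i ≠ 0 ∧ (f i)⁻¹ ∈ O.toSubring := by
  by_contra! hc
  have hm : ∀ i ∈ s, ∃ x ∈ IsLocalRing.maximalIdeal O.toSubring, (x : K) = f i := by
    intro i hi
    refine ⟨⟨f i, hf i hi⟩, fun hu => ?_, rfl⟩
    obtain ⟨y, hy⟩ := hu.exists_right_inv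
    have hy' : f i * y = 1 := congrArg Subtype.val hy
    refine hc i hi (left_ne_zero_of_mul_eq_one hy') ?_
    rw [inv_eq_of_mul_eq_one_right hy']
    exact y.2
  have : ∃ x ∈ IsLocalRing.maximalIdeal O.toSubring, (x : K) = ∑ i ∈ s, f i := by
    clear h hf hc
    classical
    induction s using Finset.induction_on with
    | empty => exact ⟨0, zero_mem _, by simp⟩
    | insert i s hi ih =>
      obtain ⟨x, hx, hxs⟩ := ih fun j hj => hm j (Finset.mem_insert_of_mem hj)
      obtain ⟨y, hy, hys⟩ := hm i (Finset.mem_insert_self _ _)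
      exact ⟨y + x, add_mem hy hx, by rw [Finset.sum_insert hi, ← hxs, ← hys]; rfl⟩
  obtain ⟨x, hx, hxs⟩ := this
  rw [h] at hxs
  have hx1 : x = 1 := Subtype.ext hxs
  subst hx1
  exact hx isUnit_one

end LocalSubrings

/-! ### The universal property of the blowup -/

section Blowups

variable {K : Type u} [Field K] {A : Type*} [CommRing A] [Algebra A K]

/-- The extension of `M` to a ring `O ⊆ K` containing the base ring is principal, generated by an
element of `M`. -/
def PrincipalOn (M : Submodule A K) (O : Subring K) : Prop :=
  ∃ g ∈ M, g ≠ 0 ∧ ∀ m ∈ M, m / g ∈ O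

/-- The local rings to which the universal property of the blowup of `Spec A` along `M` applies. -/
def Admissible (M : Submodule A K) (O : LocalSubring K) : Prop :=
  (algebraMap A K).range ≤ O.toSubring ∧ PrincipalOn M O.toSubring

lemma PrincipalOn.mono {M : Submodule A K} {O R : Subring K} (h : PrincipalOn M O) (hR : O ≤ R) :
    PrincipalOn M R := by
  obtain ⟨g, hg, h0, hm⟩ := h
  exact ⟨g, hg, h0, fun m hmM => hR (hm m hmM)⟩

lemma blowupChart_le_iff {M : Submodule A K} {g : K} {R : Subring K} :
    blowupChart M g ≤ R ↔ (algebraMap A K).range ≤ R ∧ ∀ m ∈ M, m / g ∈ R := by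
  constructor
  · intro h
    refine ⟨?_, fun m hm => h (Algebra.subset_adjoin ⟨m, hm, rfl⟩)⟩
    rintro _ ⟨a, rfl⟩
    exact h (Subalgebra.algebraMap_mem _ a)
  · rintro ⟨h1, h2⟩ x hx
    replace hx : x ∈ Algebra.adjoin A {y | ∃ m ∈ M, y = m / g} := hx
    induction hx using Algebra.adjoin_induction with
    | mem x hx => obtain ⟨m, hm, rfl⟩ := hx; exact h2 m hm
    | algebraMap a => exact h1 ⟨a, rfl⟩
    | add x y _ _ hx hy => exact add_mem hx hy
    | mul x y _ _ hx hy => exact mul_mem hx hy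

/-- The chart attached to a generator of `M R` lies in `R` for every smaller local ring `R` that
already makes `M` principal. -/
lemma blowupChart_le_of_le {M : Submodule A K} {O R : LocalSubring K} (hRO : R ≤ O)
    (hR : Admissible M R) {g : K} (hg : g ∈ M) (h0 : g ≠ 0)
    (hm : ∀ m ∈ M, m / g ∈ O.toSubring) : blowupChart M g ≤ R.toSubring := by
  obtain ⟨hA, g', hg', h0', hm'⟩ := hR
  have h1 : g' / g ∈ R.toSubring := by
    have := inv_mem_of_le hRO (hm' g hg) (by rw [inv_div]; exact hm g' hg')
    rwa [inv_div] at this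
  refine blowupChart_le_iff.mpr ⟨hA, fun m hmM => ?_⟩
  have : m / g = (m / g') * (g' / g) := by field_simp
  rw [this]
  exact mul_mem (hm' m hmM) h1

/-- The universal property of the blowup: its local rings are those that are minimal, with respect
to domination, among the local rings on which `M` becomes principal. -/
lemma mem_blowup_iff {M : Submodule A K} {O : LocalSubring K} :
    O ∈ blowup M ↔ Minimal (Admissible M) O := by
  constructor
  · rintro ⟨g, hg, h0, P, hP, rfl⟩
    have h := blowupChart_le_iff.mp (LocalSubring.le_ofPrime (blowupChart M g) P)
    refine ⟨⟨h.1, g, hg, h0, h.2⟩, fun R hR hRO => ?_⟩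
    exact ofPrime_le_of_le hRO (blowupChart_le_of_le hRO hR hg h0 h.2)
  · rintro ⟨⟨hA, g, hg, h0, hm⟩, hmin⟩
    obtain ⟨P, hP, hle⟩ := exists_ofPrime_le (blowupChart_le_iff.mpr ⟨hA, hm⟩)
    have h := blowupChart_le_iff.mp (LocalSubring.le_ofPrime (blowupChart M g) P)
    exact ⟨g, hg, h0, P, hP, le_antisymm (hmin ⟨h.1, g, hg, h0, h.2⟩ hle) hle⟩

lemma exists_mem_blowup_le {M : Submodule A K} {O : LocalSubring K} (h : Admissible M O) :
    ∃ O' ∈ blowup M, O' ≤ O := by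
  obtain ⟨hA, g, hg, h0, hm⟩ := h
  obtain ⟨P, hP, hle⟩ := exists_ofPrime_le (blowupChart_le_iff.mpr ⟨hA, hm⟩)
  exact ⟨_, ⟨g, hg, h0, P, hP, rfl⟩, hle⟩

lemma principalOn_mul_iff {M N : Submodule A K} {O : LocalSubring K}
    (hA : (algebraMap A K).range ≤ O.toSubring) :
    PrincipalOn (M * N) O.toSubring ↔ PrincipalOn M O.toSubring ∧ PrincipalOn N O.toSubring := by
  constructor
  · rintro ⟨f, hf, h0, hm⟩
    rw [Submodule.mul_eq_span_mul_set] at hf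
    obtain ⟨n, c, p, hsum⟩ := Submodule.mem_span_set'.mp hf
    choose g hg h hh hgh using fun i => Set.mem_mul.mp (p i).2
    have hdiv : ∀ g ∈ M, ∀ h ∈ N, g * h / f ∈ O.toSubring := fun g hg h hh =>
      hm _ (Submodule.mul_mem_mul hg hh)
    have hterm : ∀ i, algebraMap A K (c i) * (g i * h i / f) ∈ O.toSubring := fun i =>
      mul_mem (hA ⟨_, rfl⟩) (hdiv _ (hg i) _ (hh i))
    obtain ⟨i, -, hi0, hi⟩ := exists_inv_mem_of_sum_eq_one O Finset.univ
      (fun i => algebraMap A K (c i) * (g i * h i / f)) (fun i _ => hterm i) (by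
        rw [← div_self h0, ← hsum, Finset.sum_div]
        refine Finset.sum_congr rfl fun i _ => ?_
        rw [Algebra.smul_def, ← hgh, hsum]
        exact (mul_div_assoc _ _ _).symm)
    have hg0 : g i ≠ 0 := by rintro e; simp [e] at hi0
    have hh0 : h i ≠ 0 := by rintro e; simp [e] at hi0
    have hc0 : algebraMap A K (c i) ≠ 0 := left_ne_zero_of_mul hi0
    refine ⟨⟨g i, hg i, hg0, fun m hmM => ?_⟩, h i, hh i, hh0, fun m hmN => ?_⟩
    · have : m / g i = algebraMap A K (c i) * (m * h i / f) *
          (algebraMap A K (c i) * (g i * h i / f))⁻¹ := by field_simp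
      rw [this]
      exact mul_mem (mul_mem (hA ⟨_, rfl⟩) (hdiv _ hmM _ (hh i))) hi
    · have : m / h i = algebraMap A K (c i) * (g i * m / f) *
          (algebraMap A K (c i) * (g i * h i / f))⁻¹ := by field_simp
      rw [this]
      exact mul_mem (mul_mem (hA ⟨_, rfl⟩) (hdiv _ (hg i) _ hmN)) hi
  · rintro ⟨⟨g, hg, hg0, hgm⟩, h, hh, hh0, hhm⟩
    refine ⟨g * h, Submodule.mul_mem_mul hg hh, mul_ne_zero hg0 hh0, fun m hm => ?_⟩
    induction hm using Submodule.mul_induction_on' with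
    | mem_mul_mem x hx y hy =>
      rw [mul_div_mul_comm]
      exact mul_mem (hgm x hx) (hhm y hy)
    | add x _ y _ hx hy => rw [add_div]; exact add_mem hx hy

lemma principalOn_pow_succ_iff {M : Submodule A K} {O : LocalSubring K}
    (hA : (algebraMap A K).range ≤ O.toSubring) (n : ℕ) :
    PrincipalOn (M ^ (n + 1)) O.toSubring ↔ PrincipalOn M O.toSubring := by
  induction n with
  | zero => rw [zero_add, pow_one]
  | succ n ih => rw [pow_succ, principalOn_mul_iff hA, ih, and_self]

lemma blowup_congr {M N : Submodule A K}
    (h : ∀ O : LocalSubring K, (algebraMap A K).range ≤ O.toSubring →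
      (PrincipalOn M O.toSubring ↔ PrincipalOn N O.toSubring)) : blowup M = blowup N := by
  ext O
  have : Admissible M = Admissible N := by
    funext O
    exact propext (and_congr_right (h O))
  rw [mem_blowup_iff, mem_blowup_iff, this]

/-- Extension to `B` does not affect local rings that contain the image of `B`. -/
lemma principalOn_extend_iff {B : Type*} [CommRing B] [Algebra B K] {M : Submodule A K}
    {O : LocalSubring K} (hB : (algebraMap B K).range ≤ O.toSubring) :
    PrincipalOn (extend B M) O.toSubring ↔ PrincipalOn M O.toSubring := by
  constructor
  · rintro ⟨f, hf, h0, hm⟩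
    obtain ⟨n, c, p, hsum⟩ := Submodule.mem_span_set'.mp hf
    have hdiv : ∀ m ∈ M, m / f ∈ O.toSubring := fun m hmM => hm _ (subset_extend M hmM)
    obtain ⟨i, -, hi0, hi⟩ := exists_inv_mem_of_sum_eq_one O Finset.univ
      (fun i => algebraMap B K (c i) * ((p i : K) / f))
      (fun i _ => mul_mem (hB ⟨_, rfl⟩) (hdiv _ (p i).2)) (by
        rw [← div_self h0, ← hsum, Finset.sum_div]
        refine Finset.sum_congr rfl fun i _ => ?_
        rw [Algebra.smul_def, hsum, mul_div_assoc])
    have hp0 : (p i : K) ≠ 0 := by rintro e; simp [e] at hi0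
    have hc0 : algebraMap B K (c i) ≠ 0 := left_ne_zero_of_mul hi0
    refine ⟨p i, (p i).2, hp0, fun m hmM => ?_⟩
    have : m / p i = algebraMap B K (c i) * (m / f) *
        (algebraMap B K (c i) * ((p i : K) / f))⁻¹ := by field_simp
    rw [this]
    exact mul_mem (mul_mem (hB ⟨_, rfl⟩) (hdiv _ hmM)) hi
  · rintro ⟨g, hg, h0, hm⟩
    refine ⟨g, subset_extend M hg, h0, fun m hmM => ?_⟩
    induction hmM using Submodule.span_induction with
    | mem m hmM => exact hm m hmM
    | zero => simp
    | add x y _ _ hx hy => rw [add_div]; exact add_mem hx hy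
    | smul b x _ hx =>
      rw [Algebra.smul_def, mul_div_assoc]
      exact mul_mem (hB ⟨_, rfl⟩) hx

lemma principalOn_span_singleton {g : K} (h0 : g ≠ 0) {O : Subring K}
    (hA : (algebraMap A K).range ≤ O) : PrincipalOn (Submodule.span A {g}) O := by
  refine ⟨g, Submodule.mem_span_singleton_self g, h0, fun m hm => ?_⟩
  obtain ⟨a, rfl⟩ := Submodule.mem_span_singleton.mp hm
  rw [Algebra.smul_def, mul_div_cancel_right₀ _ h0]
  exact hA ⟨a, rfl⟩

lemma extend_eq_span_singleton {M : Submodule A K} {O : Subring K} {g : K} (hg : g ∈ M)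
    (h0 : g ≠ 0) (hm : ∀ m ∈ M, m / g ∈ O) : extend O M = Submodule.span O {g} := by
  refine le_antisymm (extend_le.mpr fun m hmM => ?_) (Submodule.span_le.mpr ?_)
  · refine Submodule.mem_span_singleton.mpr ⟨⟨m / g, hm m hmM⟩, ?_⟩
    rw [Subring.smul_def, smul_eq_mul, div_mul_cancel₀ _ h0]
  · rintro _ rfl
    exact subset_extend M hg

/-- A nonzero finitely generated module becomes principal over a valuation ring. -/
lemma principalOn_valuationSubring {M : Submodule A K} (hM : M.FG) (h0 : M ≠ ⊥)
    (W : ValuationSubring K) (hA : (algebraMap A K).range ≤ W.toSubring) :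
    PrincipalOn M W.toSubring := by
  classical
  obtain ⟨S, rfl⟩ := hM
  have hS : (S.filter (· ≠ 0)).Nonempty := by
    by_contra hne
    apply h0
    rw [Finset.not_nonempty_iff_eq_empty, Finset.filter_eq_empty_iff] at hne
    rw [Submodule.span_eq_bot]
    exact fun x hx => not_not.mp (hne hx)
  obtain ⟨g, hg, hmax⟩ := Finset.exists_max_image _ W.valuation hS
  rw [Finset.mem_filter] at hg
  refine ⟨g, Submodule.subset_span hg.1, hg.2, fun m hm => ?_⟩
  induction hm using Submodule.span_induction with
  | mem m hm =>
    rcases eq_or_ne m 0 with rfl | hm0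
    · simp
    refine (W.valuation_le_one_iff _).mp ?_
    rw [map_div₀]
    exact div_le_one_of_le₀ (hmax m (Finset.mem_filter.mpr ⟨hm, hm0⟩)) zero_le
  | zero => simp
  | add x y _ _ hx hy => rw [add_div]; exact add_mem hx hy
  | smul a x _ hx =>
    rw [Algebra.smul_def, mul_div_assoc]
    exact mul_mem (hA ⟨a, rfl⟩) hx

end Blowups

/-! ### Gauss blowups -/

section GaussBlowup

variable {k : Type*} {K : Type u} [Field k] [Field K] [Algebra k K]
variable {A : Type*} [CommRing A] [Algebra A K] {r : ℕ} (δ : Fin r → Derivation k K K)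

lemma algebraMap_subring_range (O : Subring K) : (algebraMap O K).range = O := by
  ext x
  exact ⟨fun ⟨y, hy⟩ => hy ▸ y.2, fun hx => ⟨⟨x, hx⟩, rfl⟩⟩

/-- `F` commutes with localization. -/
lemma F_extend_ofPrime (P : Ideal (algebraMap A K).range) [P.IsPrime] (M : Submodule A K) :
    F δ (extend (LocalSubring.ofPrime (algebraMap A K).range P).toSubring M) =
      extend (LocalSubring.ofPrime (algebraMap A K).range P).toSubring (F δ M) := by
  set O := LocalSubring.ofPrime (algebraMap A K).range P with hO
  have hA : (algebraMap A K).range ≤ O.toSubring := LocalSubring.le_ofPrime _ P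
  refine F_extend δ (by rwa [algebraMap_subring_range]) M ?_
  rintro ⟨x, hx⟩ f hf
  have hf' : jet δ f ∈ Submodule.span O.toSubring (jet δ '' (M : Set K)) :=
    Submodule.subset_span ⟨f, hf, rfl⟩
  have hA' : ∀ a : A, algebraMap A K a ∈ jetSubring δ _ f hf' := fun a =>
    ⟨⟨⟨_, hA ⟨a, rfl⟩⟩, rfl⟩, Submodule.subset_span ⟨_, M.smul_mem a hf, by rw [Algebra.smul_def]⟩⟩
  suffices x ∈ jetSubring δ _ f hf' from this.2
  obtain ⟨⟨_, a, rfl⟩, ⟨_, s, rfl⟩, hs, rfl⟩ := exists_of_mem_ofPrime hx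
  exact mul_mem (hA' a) (inv_mem_jetSubring δ hf' (hA' s) ⟨⟨_, inv_mem_ofPrime hs⟩, rfl⟩)

lemma extend_J_ofPrime (P : Ideal (algebraMap A K).range) [P.IsPrime] (M : Submodule A K) (n : ℕ) :
    J δ (extend (LocalSubring.ofPrime (algebraMap A K).range P).toSubring M) n =
      extend (LocalSubring.ofPrime (algebraMap A K).range P).toSubring (J δ M n) := by
  induction n with
  | zero => rfl
  | succ n ih =>
    rw [J, J, ih, F_extend_ofPrime, extend_mul]
    rw [algebraMap_subring_range]
    exact LocalSubring.le_ofPrime _ P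

/-- On the blowup along `M`, the module `F(M)` generates `F` of the principal module generated by
`M`: the jets of the elements of `O M` are obtained from those of `M` and from `m = (m / g) g`. -/
lemma F_extend_of_mem_blowup {M : Submodule A K} {O : LocalSubring K} (hO : O ∈ blowup M) :
    F δ (extend O.toSubring M) = extend O.toSubring (F δ M) := by
  obtain ⟨g, hg, h0, P, hP, rfl⟩ := hO
  set O := LocalSubring.ofPrime (blowupChart M g) P with hO
  obtain ⟨hA, hm⟩ := blowupChart_le_iff.mp (LocalSubring.le_ofPrime (blowupChart M g) P)
  refine F_extend δ (by rwa [algebraMap_subring_range]) M ?_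
  have hg' : jet δ g ∈ Submodule.span O.toSubring (jet δ '' (M : Set K)) :=
    Submodule.subset_span ⟨g, hg, rfl⟩
  have hchart : blowupChart M g ≤ jetSubring δ _ g hg' := by
    refine blowupChart_le_iff.mpr ⟨?_, fun m hmM => ⟨⟨⟨_, hm m hmM⟩, rfl⟩, ?_⟩⟩
    · rintro _ ⟨a, rfl⟩
      exact ⟨⟨⟨_, hA ⟨a, rfl⟩⟩, rfl⟩,
        Submodule.subset_span ⟨_, M.smul_mem a hg, by rw [Algebra.smul_def]⟩⟩
    · rw [div_mul_cancel₀ _ h0]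
      exact Submodule.subset_span ⟨m, hmM, rfl⟩
  have hall : O.toSubring ≤ jetSubring δ _ g hg' := by
    intro x hx
    obtain ⟨a, s, hs, rfl⟩ := exists_of_mem_ofPrime hx
    exact mul_mem (hchart a.2)
      (inv_mem_jetSubring δ hg' (hchart s.2) ⟨⟨_, inv_mem_ofPrime hs⟩, rfl⟩)
  rintro ⟨x, hx⟩ f hf
  have := (hall (mul_mem hx (hm f hf))).2
  rwa [mul_assoc, div_mul_cancel₀ _ h0] at this

/-- On the blowup along `M` one has `F(M) = Mʳ⁺¹ ⋀ʳ Ω`. -/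
lemma extend_F_of_mem_blowup {M : Submodule A K} {O : LocalSubring K} (hO : O ∈ blowup M) :
    extend O.toSubring (F δ M) =
      extend O.toSubring M ^ (r + 1) * canonical δ O.toSubring := by
  obtain ⟨-, g, hg, h0, hm⟩ := (mem_blowup_iff.mp hO).prop
  rw [← F_extend_of_mem_blowup δ hO, extend_eq_span_singleton hg h0 hm, F_span_singleton]

/-- The Gauss blowup of the blowup along `M` is the blowup along `M F(M)`. -/
lemma gaussBlowup_blowup (M : Submodule A K) :
    gaussBlowup δ (blowup M) = blowup (M * F δ M) := by
  have key : ∀ O ∈ blowup M, ∀ R : LocalSubring K, O.toSubring ≤ R.toSubring →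
      (PrincipalOn (canonical δ O.toSubring) R.toSubring ↔ PrincipalOn (F δ M) R.toSubring) := by
    intro O hO R hOR
    -- `F(M) O` is `gʳ⁺¹` times the canonical module.
    have hOR' : (algebraMap O.toSubring K).range ≤ R.toSubring := by
      rwa [algebraMap_subring_range]
    obtain ⟨-, g, hg, h0, hm⟩ := (mem_blowup_iff.mp hO).prop
    rw [← principalOn_extend_iff hOR' (M := F δ M), extend_F_of_mem_blowup δ hO,
      principalOn_mul_iff hOR', principalOn_pow_succ_iff hOR',
      extend_eq_span_singleton hg h0 hm]
    exact (and_iff_right (principalOn_span_singleton h0 hOR')).symm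
  ext O'
  simp only [gaussBlowup, Set.mem_iUnion, exists_prop]
  constructor
  · rintro ⟨O, hO, hO'⟩
    obtain ⟨⟨hOO', hpr⟩, hmin⟩ := mem_blowup_iff.mp hO'
    rw [algebraMap_subring_range] at hOO'
    obtain ⟨g, hg, h0, P, hP, hOP⟩ := id hO
    have hA := (mem_blowup_iff.mp hO).prop.1
    have hm : ∀ m ∈ M, m / g ∈ O.toSubring := by
      rw [hOP]
      exact (blowupChart_le_iff.mp (LocalSubring.le_ofPrime (blowupChart M g) P)).2
    refine mem_blowup_iff.mpr ⟨⟨hA.trans hOO', (principalOn_mul_iff (hA.trans hOO')).mpr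
      ⟨⟨g, hg, h0, fun m hmM => hOO' (hm m hmM)⟩, (key O hO O' hOO').mp hpr⟩⟩, ?_⟩
    rintro R ⟨hAR, hprR⟩ hRO'
    rw [principalOn_mul_iff hAR] at hprR
    have hchart := blowupChart_le_of_le hRO' ⟨hAR, hprR.1⟩ hg h0 fun m hmM => hOO' (hm m hmM)
    -- `R` need not dominate `O`, but it contains the chart, and the denominators of `O` are units
    -- of `O'`, hence of `R`.
    have hOR : O.toSubring ≤ R.toSubring := by
      intro x hx
      rw [hOP] at hx
      obtain ⟨a, s, hs, rfl⟩ := exists_of_mem_ofPrime hx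
      refine mul_mem (hchart a.2) (inv_mem_of_le hRO' (hchart s.2) (hOO' ?_))
      rw [hOP]
      exact inv_mem_ofPrime hs
    exact hmin ⟨by rwa [algebraMap_subring_range], (key O hO R hOR).mpr hprR.2⟩ hRO'
  · intro hO'
    obtain ⟨⟨hA, hpr⟩, hmin⟩ := mem_blowup_iff.mp hO'
    rw [principalOn_mul_iff hA] at hpr
    obtain ⟨O, hO, hOO'⟩ := exists_mem_blowup_le ⟨hA, hpr.1⟩
    obtain ⟨hAO, hprO⟩ := (mem_blowup_iff.mp hO).prop
    refine ⟨O, hO, mem_blowup_iff.mpr ⟨⟨?_, (key O hO O' hOO'.1).mpr hpr.2⟩, ?_⟩⟩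
    · rw [algebraMap_subring_range]
      exact hOO'.1
    rintro R ⟨hOR, hprR⟩ hRO'
    rw [algebraMap_subring_range] at hOR
    exact hmin ⟨hAO.trans hOR, (principalOn_mul_iff (hAO.trans hOR)).mpr
      ⟨hprO.mono hOR, (key O hO R hOR).mp hprR⟩⟩ hRO'

lemma gaussBlowup_iUnion {ι : Sort*} (W : ι → Set (LocalSubring K)) :
    gaussBlowup δ (⋃ i, W i) = ⋃ i, gaussBlowup δ (W i) := by
  simp only [gaussBlowup, Set.biUnion_iUnion]

/-- If `F(J)ʳ⁺² = F(J F(J))` then the second Gauss blowup over the blowup along `J` is trivial. -/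
lemma blowup_J_succ_succ {M : Submodule A K} {t : ℕ}
    (h : F δ (J δ M t) ^ (r + 2) = F δ (J δ M t * F δ (J δ M t))) :
    blowup (J δ M (t + 2)) = blowup (J δ M (t + 1)) := by
  refine blowup_congr fun O hA => ?_
  rw [J, show F δ (J δ M (t + 1)) = F δ (J δ M t) ^ (r + 2) from h.symm, principalOn_mul_iff hA,
    principalOn_pow_succ_iff hA, J, principalOn_mul_iff hA, and_assoc, and_self]

end GaussBlowup

/-! ### Integral extensions of finitely generated domains -/

section IntegralExtensions

/-- In characteristic zero, a ring that lies integrally between a finitely generated `k`-domain and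
its field of fractions is a finitely generated `k`-algebra: by Noether normalization it is a
submodule of the integral closure of a polynomial ring in a finite separable extension. -/
lemma finiteType_of_isIntegral (k S T Ω : Type*) [Field k] [CharZero k] [CommRing S] [IsDomain S]
    [Algebra k S] [Algebra.FiniteType k S] [CommRing T] [Algebra k T] [Algebra S T]
    [IsScalarTower k S T] [Field Ω] [Algebra S Ω] [IsFractionRing S Ω] [Algebra T Ω]
    [IsScalarTower S T Ω] (hinj : Function.Injective (algebraMap T Ω)) [Algebra.IsIntegral S T] :
    Algebra.FiniteType k T := by
  obtain ⟨n, g, ginj, gfin⟩ := exists_finite_inj_algHom_of_fg k S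
  let P := MvPolynomial (Fin n) k
  let : Algebra P S := g.toRingHom.toAlgebra
  let : Algebra P Ω := ((algebraMap S Ω).comp (algebraMap P S)).toAlgebra
  let : Algebra P T := ((algebraMap S T).comp (algebraMap P S)).toAlgebra
  have : IsScalarTower k P S := IsScalarTower.of_algebraMap_eq fun x => (g.commutes x).symm
  have : IsScalarTower P S Ω := IsScalarTower.of_algebraMap_eq fun _ => rfl
  have : IsScalarTower P S T := IsScalarTower.of_algebraMap_eq fun _ => rfl
  have : IsScalarTower k P T := IsScalarTower.of_algebraMap_eq fun x => by
    rw [IsScalarTower.algebraMap_apply k S T, IsScalarTower.algebraMap_apply k P S]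
    rfl
  have : IsScalarTower P T Ω := IsScalarTower.of_algebraMap_eq fun x => by
    rw [IsScalarTower.algebraMap_apply P S Ω, IsScalarTower.algebraMap_apply P S T,
      ← IsScalarTower.algebraMap_apply S T Ω]
  have : Module.Finite P S := gfin
  have : FaithfulSMul P S := (faithfulSMul_iff_algebraMap_injective P S).mpr ginj
  have : FaithfulSMul P Ω := (faithfulSMul_iff_algebraMap_injective P Ω).mpr
    ((IsFractionRing.injective S Ω).comp ginj)
  let := FractionRing.liftAlgebra P Ω
  have := FractionRing.isScalarTower_liftAlgebra P Ω
  have : FiniteDimensional (FractionRing P) Ω :=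
    Module.Finite.of_isLocalization P S (nonZeroDivisors P)
  have : CharZero (FractionRing P) :=
    charZero_of_injective_algebraMap (algebraMap k (FractionRing P)).injective
  have : IsNoetherian P (integralClosure P Ω) :=
    IsIntegralClosure.isNoetherian P (FractionRing P) Ω (integralClosure P Ω)
  have hint : ∀ t : T, IsIntegral P (algebraMap T Ω t) := fun t =>
    (isIntegral_trans (R := P) (A := S) t (Algebra.IsIntegral.isIntegral t)).algebraMap
  let f : T →ₗ[P] integralClosure P Ω :=
    { toFun := fun t => ⟨algebraMap T Ω t, hint t⟩
      map_add' := fun x y => Subtype.ext (map_add _ x y)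
      map_smul' := fun p x => Subtype.ext (by
        simp [Algebra.smul_def, ← IsScalarTower.algebraMap_apply]) }
  have hf : Function.Injective f := fun x y h => hinj (congrArg Subtype.val h)
  have : IsNoetherian P T := isNoetherian_of_injective f hf
  have : Algebra.FiniteType P T := Module.Finite.finiteType T
  exact Algebra.FiniteType.trans (S := P) inferInstance inferInstance

/-- The valuative criterion of integrality. -/
lemma isIntegral_of_forall_valuationSubring {S Ω : Type*} [CommRing S] [Field Ω] [Algebra S Ω]
    {x : Ω} (hx : ∀ W : ValuationSubring Ω, (algebraMap S Ω).range ≤ W.toSubring → x ∈ W) :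
    IsIntegral S x := by
  by_contra hne
  have : IsIntegrallyClosedIn (integralClosure S Ω).toSubring Ω :=
    inferInstanceAs (IsIntegrallyClosedIn (integralClosure S Ω) Ω)
  obtain ⟨W, hW, hxW⟩ := Subring.exists_le_valuationSubring_of_isIntegrallyClosedIn
    (R := (integralClosure S Ω).toSubring) (x := x) hne
  refine hxW (hx W ?_)
  rintro _ ⟨s, rfl⟩
  exact hW (isIntegral_algebraMap : IsIntegral S (algebraMap S Ω s))

end IntegralExtensions

/-! ### Graded algebras attached to base `b` expansions -/

section ExpansionAlgebra

variable {K : Type u} [Field K] {A : Type*} [CommRing A] [Algebra A K]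

/-- The graded algebra attached to a sequence with `Mⱼ ^ b ≤ Mⱼ₊₁`, whose part of degree `i` is the
product given by the base `b` expansion of `i`. -/
noncomputable def expansionAlgebra (b : ℕ) (hb : 2 ≤ b) (M : ℕ → Submodule A K)
    (hM : ∀ j, M j ^ b ≤ M (j + 1)) : Subalgebra A K[X] where
  carrier := {f | ∀ i, f.coeff i ∈ expansionProd b M i}
  mul_mem' {f g} hf hg i := by
    rw [coeff_mul]
    refine Submodule.sum_mem _ fun x hx => ?_
    rw [← Finset.HasAntidiagonal.mem_antidiagonal.mp hx]
    exact expansionProd_mul_le hb _ M hM _ _ rfl (Submodule.mul_mem_mul (hf _) (hg _))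
  add_mem' {f g} hf hg i := by
    rw [coeff_add]
    exact add_mem (hf i) (hg i)
  algebraMap_mem' a i := by
    rw [Polynomial.algebraMap_apply, coeff_C]
    split_ifs with h
    · subst h
      rw [expansionProd_zero]
      exact Submodule.algebraMap_mem a
    · exact zero_mem _

lemma R_eq_expansionAlgebra {k : Type*} [Field k] [CharZero k] [Algebra k K] [Algebra k A]
    [IsScalarTower k A K] {r : ℕ} (δ : Fin r → Derivation k K K) (I : Submodule A K) :
    R δ I = expansionAlgebra (r + 2) (by omega) (L δ I) fun j => F_pow_le (k := k) δ (J δ I j) :=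
  rfl

lemma monomial_mem_expansionAlgebra {b : ℕ} {hb : 2 ≤ b} {M : ℕ → Submodule A K}
    {hM : ∀ j, M j ^ b ≤ M (j + 1)} {n : ℕ} {c : K} :
    monomial n c ∈ expansionAlgebra b hb M hM ↔ c ∈ expansionProd b M n := by
  constructor
  · intro h
    simpa using h n
  · intro h i
    rw [coeff_monomial]
    split_ifs with hi
    · exact hi ▸ h
    · exact zero_mem _

lemma expansionProd_pow {b : ℕ} (hb : 2 ≤ b) (j : ℕ) : ∀ M : ℕ → Submodule A K,
    expansionProd b M (b ^ j) = M j := by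
  induction j with
  | zero =>
    intro M
    rw [expansionProd_step hb, pow_zero, Nat.mod_eq_of_lt (by omega), Nat.div_eq_of_lt (by omega),
      expansionProd_zero, pow_one, mul_one]
  | succ j ih =>
    intro M
    rw [expansionProd_step hb, pow_succ, Nat.mul_mod_left, pow_zero, one_mul,
      Nat.mul_div_cancel _ (by omega), ih]

lemma expansionProd_le_pow {b : ℕ} (hb : 2 ≤ b) (i : ℕ) : ∀ (M : ℕ → Submodule A K)
    (N : Submodule A K), (∀ j, M j ≤ N ^ b ^ j) → expansionProd b M i ≤ N ^ i := by
  induction i using Nat.strong_induction_on with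
  | _ i ih =>
    intro M N h
    rcases Nat.eq_zero_or_pos i with rfl | hi
    · rw [expansionProd_zero, pow_zero]
    rw [expansionProd_step hb]
    have h0 : M 0 ≤ N := by simpa using h 0
    have h1 := ih (i / b) (Nat.div_lt_self hi (by omega)) (fun j => M (j + 1)) (N ^ b) fun j => by
      rw [← pow_mul, ← pow_succ']
      exact h (j + 1)
    calc M 0 ^ (i % b) * expansionProd b (fun j => M (j + 1)) (i / b)
        ≤ N ^ (i % b) * (N ^ b) ^ (i / b) := mul_le_mul' (pow_le_pow_left' h0 _) h1
      _ = N ^ i := by rw [← pow_mul, ← pow_add, Nat.mod_add_div]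

lemma pow_le_expansionProd {b : ℕ} (hb : 2 ≤ b) (M : ℕ → Submodule A K)
    (hM : ∀ j, M j ^ b ≤ M (j + 1)) (i : ℕ) : M 0 ^ i ≤ expansionProd b M i := by
  induction i with
  | zero => rw [pow_zero, expansionProd_zero]
  | succ i ih =>
    have h1 : expansionProd b M 1 = M 0 := by simpa using expansionProd_pow hb 0 M
    rw [pow_succ]
    refine le_trans (mul_le_mul' ih h1.ge) ?_
    exact expansionProd_mul_le hb _ M hM i 1 rfl

lemma extend_expansionProd {B : Type*} [CommRing B] [Algebra B K]
    (h : (algebraMap A K).range ≤ (algebraMap B K).range) (b : ℕ) (M : ℕ → Submodule A K) (i : ℕ) :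
    extend B (expansionProd b M i) = expansionProd b (fun j => extend B (M j)) i := by
  let φ : Submodule A K →* Submodule B K :=
    { toFun := extend B
      map_one' := extend_one h
      map_mul' := extend_mul h }
  have := map_prod φ (fun j => M j ^ (i / b ^ j % b)) (Finset.range (i + 1))
  simp only [map_pow] at this
  exact this

/-- If the algebra is finitely generated, then no new generators are needed in the degrees `b ^ t`
for large `t`. The sequence `M` may then be replaced beyond `t` by the powers of `M t`, as products
of elements of lower degree never use the inclusion `M t ^ b ≤ M (t + 1)`. -/
lemma exists_pow_eq_of_finiteType {k : Type*} [Field k] [Algebra k A] [Algebra k K]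
    [IsScalarTower k A K] {b : ℕ} {hb : 2 ≤ b} {M : ℕ → Submodule A K}
    {hM : ∀ j, M j ^ b ≤ M (j + 1)} (hfin : Algebra.FiniteType k (expansionAlgebra b hb M hM)) :
    ∃ T, ∀ t ≥ T, M t ^ b = M (t + 1) := by
  obtain ⟨S, hS⟩ := hfin.out
  obtain ⟨D, hD⟩ : ∃ D, ∀ f ∈ S, (f : K[X]).natDegree ≤ D :=
    ⟨S.sup fun f => (f : K[X]).natDegree, fun f hf => Finset.le_sup (f := fun f : _ =>
      ((f : expansionAlgebra b hb M hM) : K[X]).natDegree) hf⟩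
  refine ⟨D, fun t ht => le_antisymm (hM t) fun y hy => ?_⟩
  let M' : ℕ → Submodule A K := fun j => if j ≤ t then M j else M t ^ b ^ (j - t)
  have hM' : ∀ j, M' j ^ b ≤ M' (j + 1) := by
    intro j
    rcases lt_trichotomy j t with h | h | h
    · simp only [M', if_pos h.le, if_pos (show j + 1 ≤ t from h)]
      exact hM j
    · subst h
      simp [M']
    · simp only [M', if_neg (show ¬ j ≤ t by omega), if_neg (show ¬ j + 1 ≤ t by omega)]
      rw [← pow_mul, ← pow_succ, Nat.sub_add_comm h.le]
  have hlow : ∀ i < b ^ (t + 1), expansionProd b M' i = expansionProd b M i := by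
    intro i hi
    refine Finset.prod_congr rfl fun j _ => ?_
    by_cases hj : j ≤ t
    · simp only [M', if_pos hj]
    · rw [Nat.div_eq_of_lt (hi.trans_le (Nat.pow_le_pow_right (by omega) (by omega))),
        Nat.zero_mod, pow_zero, pow_zero]
  have hall : ∀ f : expansionAlgebra b hb M hM, (f : K[X]) ∈ expansionAlgebra b hb M' hM' := by
    intro f
    have hf : f ∈ Algebra.adjoin k (S : Set (expansionAlgebra b hb M hM)) := hS ▸ Algebra.mem_top
    induction hf using Algebra.adjoin_induction with
    | mem f hf =>
      intro i
      by_cases hi : i < b ^ (t + 1)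
      · rw [hlow i hi]
        exact f.2 i
      · rw [coeff_eq_zero_of_natDegree_lt]
        · exact zero_mem _
        · have h1 := hD f hf
          have h2 : t + 1 < b ^ (t + 1) := Nat.lt_pow_self (by omega)
          omega
    | algebraMap c =>
      rw [IsScalarTower.algebraMap_apply k A (expansionAlgebra b hb M hM)]
      exact Subalgebra.algebraMap_mem _ _
    | add x y _ _ hx hy => exact add_mem hx hy
    | mul x y _ _ hx hy => exact mul_mem hx hy
  have h1 : monomial (b ^ (t + 1)) y ∈ expansionAlgebra b hb M hM := by
    rw [monomial_mem_expansionAlgebra, expansionProd_pow hb]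
    exact hy
  have h2 := hall ⟨_, h1⟩
  rw [monomial_mem_expansionAlgebra, expansionProd_pow hb] at h2
  simpa [M'] using h2

/-- The Rees algebra `⨁ Mⁿ` of a fractional ideal. -/
noncomputable def rees (M : Submodule A K) : Subalgebra A K[X] :=
  Algebra.adjoin A (monomial 1 '' (M : Set K))

lemma rees_fg {M : Submodule A K} (hM : M.FG) : (rees M).FG := by
  classical
  obtain ⟨S, rfl⟩ := hM
  have : rees (Submodule.span A (S : Set K)) =
      Algebra.adjoin A ((S.image (monomial 1) : Finset K[X]) : Set K[X]) := by
    have h : (monomial 1 '' (Submodule.span A (S : Set K) : Set K) : Set K[X]) =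
        (Submodule.span A (monomial 1 '' (S : Set K)) : Set K[X]) := by
      have := Submodule.map_span ((monomial 1 : K →ₗ[K] K[X]).restrictScalars A) (S : Set K)
      exact congrArg (SetLike.coe) this
    rw [rees, h, Algebra.adjoin_span, Finset.coe_image]
  rw [this]
  exact Subalgebra.fg_adjoin_finset _

lemma monomial_mem_rees {M : Submodule A K} (n : ℕ) {y : K} (hy : y ∈ M ^ n) :
    monomial n y ∈ rees M := by
  induction n generalizing y with
  | zero =>
    rw [pow_zero, Submodule.mem_one] at hy
    obtain ⟨a, rfl⟩ := hy
    exact Subalgebra.algebraMap_mem _ a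
  | succ n ih =>
    rw [pow_succ] at hy
    induction hy using Submodule.mul_induction_on' with
    | mem_mul_mem x hx z hz =>
      rw [← monomial_mul_monomial]
      exact mul_mem (ih hx) (Algebra.subset_adjoin ⟨z, hz, rfl⟩)
    | add x _ y _ hx hy => rw [map_add]; exact add_mem hx hy

lemma rees_le_expansionAlgebra {b : ℕ} {hb : 2 ≤ b} {M : ℕ → Submodule A K}
    {hM : ∀ j, M j ^ b ≤ M (j + 1)} : rees (M 0) ≤ expansionAlgebra b hb M hM := by
  refine Algebra.adjoin_le ?_
  rintro _ ⟨y, hy, rfl⟩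
  rw [SetLike.mem_coe, monomial_mem_expansionAlgebra]
  exact pow_le_expansionProd hb M hM 1 (by rwa [pow_one])

/-- Dropping the first term of the sequence corresponds to passing to a Veronese subalgebra. -/
lemma expansionAlgebra_fg_of_shift {b : ℕ} {hb : 2 ≤ b} {M : ℕ → Submodule A K}
    {hM : ∀ j, M j ^ b ≤ M (j + 1)} (h0 : (M 0).FG)
    (h : (expansionAlgebra b hb (fun j => M (j + 1)) fun j => hM (j + 1)).FG) :
    (expansionAlgebra b hb M hM).FG := by
  let φ : K[X] →ₐ[A] K[X] := (expand K b).restrictScalars A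
  have key : expansionAlgebra b hb M hM =
      (expansionAlgebra b hb (fun j => M (j + 1)) fun j => hM (j + 1)).map φ ⊔ rees (M 0) := by
    apply le_antisymm
    · intro f hf
      rw [f.as_sum_range]
      refine Subalgebra.sum_mem _ fun i _ => ?_
      have hi := hf i
      rw [expansionProd_step hb] at hi
      generalize f.coeff i = c at hi
      induction hi using Submodule.mul_induction_on' with
      | mem_mul_mem x hx z hz =>
        have hx' := monomial_mem_rees _ hx
        have hz' : φ (monomial (i / b) z) ∈ (expansionAlgebra b hb (fun j => M (j + 1))
            fun j => hM (j + 1)).map φ :=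
          ⟨_, (monomial_mem_expansionAlgebra (hM := fun j => hM (j + 1))).mpr hz, rfl⟩
        have e : monomial i (x * z) = monomial (i % b) x * φ (monomial (i / b) z) := by
          change _ = _ * expand K b _
          rw [expand_monomial, monomial_mul_monomial, mul_comm (i / b), Nat.mod_add_div]
        rw [e]
        exact mul_mem ((le_sup_right : _ ≤ _ ⊔ rees (M 0)) hx')
          ((le_sup_left : _ ≤ _ ⊔ rees (M 0)) hz')
      | add x _ y _ hx hy => rw [map_add]; exact add_mem hx hy
    · refine sup_le ?_ rees_le_expansionAlgebra
      rintro _ ⟨f, hf, rfl⟩ i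
      change (expand K b f).coeff i ∈ _
      rw [coeff_expand (by omega)]
      split_ifs with hi
      · rw [expansionProd_step hb, Nat.mod_eq_zero_of_dvd hi, pow_zero, one_mul]
        exact hf _
      · exact zero_mem _
  rw [key]
  exact (h.map φ).sup (rees_fg h0)

lemma expansionAlgebra_fg_of_add {b : ℕ} {hb : 2 ≤ b} (N : ℕ) : ∀ {M : ℕ → Submodule A K}
    {hM : ∀ j, M j ^ b ≤ M (j + 1)}, (∀ j, (M j).FG) →
    (expansionAlgebra b hb (fun j => M (j + N)) fun j => by
      rw [Nat.add_right_comm]; exact hM (j + N)).FG →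
    (expansionAlgebra b hb M hM).FG := by
  induction N with
  | zero => exact fun _ h => h
  | succ N ih =>
    intro M hM hfg h
    exact expansionAlgebra_fg_of_shift (hfg 0)
      (ih (M := fun j => M (j + 1)) (hM := fun j => hM (j + 1)) (fun j => hfg (j + 1)) h)

/-- The Rees algebra of a nonzero fractional ideal has the same field of fractions as `K[X]`. -/
lemma isFractionRing_rees [IsDomain A] [IsFractionRing A K] {M : Submodule A K} (hM : M ≠ ⊥)
    (Ω : Type*) [Field Ω] [Algebra K[X] Ω] [IsFractionRing K[X] Ω] :
    IsFractionRing (rees M) Ω := by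
  have hΩ : ∀ x : rees M, algebraMap (rees M) Ω x = algebraMap K[X] Ω x := fun _ => rfl
  obtain ⟨y, hy, hy0⟩ := Submodule.exists_mem_ne_zero_of_ne_bot hM
  have hinj : Function.Injective (algebraMap (rees M) Ω) := by
    intro x z h
    rw [hΩ, hΩ] at h
    exact Subtype.ext (IsFractionRing.injective K[X] Ω h)
  have : FaithfulSMul (rees M) Ω := (faithfulSMul_iff_algebraMap_injective _ _).mpr hinj
  have hden : ∀ p : K[X], ∃ a : A, a ≠ 0 ∧ C (algebraMap A K a) * p ∈ rees M := by
    intro p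
    induction p using Polynomial.induction_on' with
    | add p q hp hq =>
      obtain ⟨a, ha, hap⟩ := hp
      obtain ⟨c, hc, hcq⟩ := hq
      refine ⟨a * c, mul_ne_zero ha hc, ?_⟩
      have e : C (algebraMap A K (a * c)) * (p + q) =
          algebraMap A K[X] c * (C (algebraMap A K a) * p) +
          algebraMap A K[X] a * (C (algebraMap A K c) * q) := by
        rw [map_mul, C_mul, Polynomial.algebraMap_apply, Polynomial.algebraMap_apply]
        ring
      rw [e]
      exact add_mem (mul_mem (Subalgebra.algebraMap_mem _ _) hap)
        (mul_mem (Subalgebra.algebraMap_mem _ _) hcq)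
    | monomial n c =>
      obtain ⟨a, s, hs, h⟩ := IsFractionRing.div_surjective (A := A) (c / y ^ n)
      have hs0 : algebraMap A K s ≠ 0 := fun h0 =>
        nonZeroDivisors.ne_zero hs ((FaithfulSMul.algebraMap_eq_zero_iff A K).mp h0)
      refine ⟨s, nonZeroDivisors.ne_zero hs, ?_⟩
      have e : algebraMap A K s * c = a • y ^ n := by
        rw [Algebra.smul_def]
        rw [div_eq_div_iff hs0 (pow_ne_zero n hy0)] at h
        rw [h, mul_comm]
      rw [C_mul_monomial, e]
      exact monomial_mem_rees n (Submodule.smul_mem _ _ (Submodule.pow_mem_pow _ hy n))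
  refine IsFractionRing.of_field (rees M) Ω fun z => ?_
  obtain ⟨p, q, hq, rfl⟩ := IsFractionRing.div_surjective (A := K[X]) z
  obtain ⟨a, ha, hap⟩ := hden p
  obtain ⟨c, hc, hcq⟩ := hden q
  have hA : ∀ a : A, a ≠ 0 → algebraMap K[X] Ω (C (algebraMap A K a)) ≠ 0 := by
    intro a ha h
    rw [FaithfulSMul.algebraMap_eq_zero_iff, C_eq_zero, FaithfulSMul.algebraMap_eq_zero_iff] at h
    exact ha h
  have hmem : ∀ a : A, C (algebraMap A K a) ∈ rees M := fun a => Subalgebra.algebraMap_mem _ a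
  refine ⟨⟨_, mul_mem (hmem c) hap⟩, ⟨_, mul_mem (hmem a) hcq⟩, ?_⟩
  rw [hΩ, hΩ]
  have hq0 : algebraMap K[X] Ω q ≠ 0 := fun h0 =>
    nonZeroDivisors.ne_zero hq ((FaithfulSMul.algebraMap_eq_zero_iff K[X] Ω).mp h0)
  have := hA a ha
  have := hA c hc
  simp only [map_mul]
  field_simp

/-- If over every valuation ring the sequence `M` is the sequence of powers `M 0 ^ b ^ j`, then the
algebra is integral over the Rees algebra of `M 0`, hence finitely generated. -/
lemma expansionAlgebra_finiteType {k : Type*} [Field k] [CharZero k] [Algebra k A] [Algebra k K]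
    [IsScalarTower k A K] [Algebra.FiniteType k A] [IsDomain A] [IsFractionRing A K]
    {b : ℕ} {hb : 2 ≤ b} {M : ℕ → Submodule A K} {hM : ∀ j, M j ^ b ≤ M (j + 1)}
    (hfg : (M 0).FG) (h0 : M 0 ≠ ⊥)
    (hval : ∀ W : ValuationSubring K, (algebraMap A K).range ≤ W.toSubring →
      ∀ j, extend W.toSubring (M j) ≤ extend W.toSubring (M 0) ^ b ^ j) :
    Algebra.FiniteType k (expansionAlgebra b hb M hM) := by
  let Ω := FractionRing K[X]
  let S := rees (M 0)
  let T := expansionAlgebra b hb M hM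
  let : Algebra S T := (Subalgebra.inclusion rees_le_expansionAlgebra).toAlgebra
  have : IsScalarTower k S T := IsScalarTower.of_algebraMap_eq fun _ => rfl
  have : IsScalarTower S T Ω := IsScalarTower.of_algebraMap_eq fun _ => rfl
  have : IsFractionRing S Ω := isFractionRing_rees h0 Ω
  have : Algebra.FiniteType A S := S.fg_iff_finiteType.mp (rees_fg hfg)
  have : Algebra.FiniteType k S := Algebra.FiniteType.trans (S := A) inferInstance inferInstance
  have hinj : Function.Injective (algebraMap T Ω) := fun x y h =>
    Subtype.ext (IsFractionRing.injective K[X] Ω h)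
  have : Algebra.IsIntegral S T := by
    refine ⟨fun t => (isIntegral_algebraMap_iff hinj).mp ?_⟩
    change IsIntegral S (algebraMap K[X] Ω t.1)
    -- It suffices to treat a homogeneous element `c Xⁱ`; over a valuation ring `W` of `K(X)`, with
    -- trace `W'` on `K`, the coefficient `c` lies in `(M 0) ^ i W'`.
    rw [t.1.as_sum_range, map_sum]
    refine IsIntegral.sum _ fun i _ => isIntegral_of_forall_valuationSubring fun W hW => ?_
    let W' : ValuationSubring K := W.comap ((algebraMap K[X] Ω).comp C)
    have hA : (algebraMap A K).range ≤ W'.toSubring := by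
      rintro _ ⟨a, rfl⟩
      exact hW ⟨algebraMap A S a, rfl⟩
    have hA' : (algebraMap A K).range ≤ (algebraMap W'.toSubring K).range := by
      rwa [algebraMap_subring_range]
    have hc : t.1.coeff i ∈ extend W'.toSubring (M 0 ^ i) := by
      rw [extend_pow hA']
      refine expansionProd_le_pow hb i _ _ (hval W' hA) ?_
      rw [← extend_expansionProd hA']
      exact subset_extend _ (t.2 i)
    generalize t.1.coeff i = y at hc
    induction hc using Submodule.span_induction with
    | mem x hx => exact hW ⟨⟨_, monomial_mem_rees i hx⟩, rfl⟩
    | zero => rw [map_zero, map_zero]; exact zero_mem _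
    | add x y _ _ hx hy => rw [map_add, map_add]; exact add_mem hx hy
    | smul c x _ hx =>
      rw [Subring.smul_def, smul_eq_mul, ← C_mul_monomial, map_mul]
      exact mul_mem c.2 hx
  exact finiteType_of_isIntegral k S T Ω hinj

end ExpansionAlgebra

/-! ### Finite generation of `R(I)` -/

section FiniteGeneration

variable {k : Type*} {K : Type u} [Field k] [CharZero k] [Field K] [Algebra k K]
variable {A : Type*} [CommRing A] [Algebra A K] [Algebra k A] [IsScalarTower k A K]
variable {r : ℕ} (δ : Fin r → Derivation k K K)

lemma exists_L_pow_eq_of_finiteType {I : Submodule A K} (h : Algebra.FiniteType k (R δ I)) :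
    ∃ T, ∀ t ≥ T, L δ I t ^ (r + 2) = L δ I (t + 1) :=
  exists_pow_eq_of_finiteType (M := L δ I) (b := r + 2) (hb := by omega)
    (hM := fun j => F_pow_le (k := k) δ (J δ I j)) h

lemma R_finiteType [Algebra.FiniteType k A] [IsDomain A] [IsFractionRing A K]
    (hδ : LinearIndependent K δ) {I : Submodule A K} (hI : I.FG) (hI0 : I ≠ ⊥) (N : ℕ)
    (h : ∀ W : ValuationSubring K, (algebraMap A K).range ≤ W.toSubring → ∀ n ≥ N,
      extend W.toSubring (L δ I (n + 1)) = extend W.toSubring (L δ I n) ^ (r + 2)) :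
    Algebra.FiniteType k (R δ I) := by
  have hLfg : ∀ j, (L δ I j).FG := fun j => F_fg δ (J_fg δ hI j)
  have hM : ∀ j, L δ I (j + N) ^ (r + 2) ≤ L δ I (j + 1 + N) := fun j => by
    rw [Nat.add_right_comm]
    exact F_pow_le (k := k) δ (J δ I (j + N))
  have h1 : Algebra.FiniteType k
      (expansionAlgebra (r + 2) (by omega) (fun j => L δ I (j + N)) hM) := by
    refine expansionAlgebra_finiteType (hLfg _) (F_ne_bot δ hδ (J_ne_bot δ hδ hI0 _)) ?_
    intro W hW j
    induction j with
    | zero => simp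
    | succ j ih =>
      have e : j + 1 + N = j + N + 1 := by omega
      rw [e, h W hW (j + N) (by omega), pow_succ (r + 2) j, pow_mul]
      exact pow_le_pow_left' ih _
  have h2 : Algebra.FiniteType A
      (expansionAlgebra (r + 2) (by omega) (fun j => L δ I (j + N)) hM) :=
    Algebra.FiniteType.of_restrictScalars_finiteType k A _
  have h3 : (R δ I).FG := by
    rw [R_eq_expansionAlgebra]
    exact expansionAlgebra_fg_of_add N hLfg
      ((Subalgebra.fg_iff_finiteType _).mpr h2)
  have : Algebra.FiniteType A (R δ I) := (Subalgebra.fg_iff_finiteType _).mp h3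
  exact Algebra.FiniteType.trans (S := A) inferInstance inferInstance

end FiniteGeneration

/-! ### Inclusions checked on localizations -/

section LocalGlobal

variable {K : Type u} [Field K] {A : Type*} [CommRing A] [Algebra A K]

lemma mul_mem_of_mem_range {N : Submodule A K} {c y : K} (hc : c ∈ (algebraMap A K).range)
    (hy : y ∈ N) : c * y ∈ N := by
  obtain ⟨a, rfl⟩ := hc
  rw [← Algebra.smul_def]
  exact N.smul_mem a hy

lemma exists_mul_mem_of_mem_extend_ofPrime {P : Ideal (algebraMap A K).range} [hP : P.IsPrime]
    {N : Submodule A K} {y : K}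
    (hy : y ∈ extend (LocalSubring.ofPrime (algebraMap A K).range P).toSubring N) :
    ∃ s ∉ P, (s : K) * y ∈ N := by
  have h1 : (1 : (algebraMap A K).range) ∉ P := (Ideal.ne_top_iff_one P).mp hP.ne_top
  induction hy using Submodule.span_induction with
  | mem y hy => exact ⟨1, h1, mul_mem_of_mem_range (one_mem _) hy⟩
  | zero => exact ⟨1, h1, by simp⟩
  | add x y _ _ hx hy =>
    obtain ⟨s, hs, hsx⟩ := hx
    obtain ⟨t, ht, hty⟩ := hy
    refine ⟨s * t, fun h => (hP.mem_or_mem h).elim hs ht, ?_⟩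
    have e : ((s * t : (algebraMap A K).range) : K) * (x + y) =
        t * (s * x) + s * (t * y) := by
      push_cast
      ring
    rw [e]
    exact add_mem (mul_mem_of_mem_range t.2 hsx) (mul_mem_of_mem_range s.2 hty)
  | smul c x _ hx =>
    obtain ⟨s, hs, hsx⟩ := hx
    obtain ⟨a, t, ht, hc⟩ := exists_of_mem_ofPrime c.2
    have ht0 : (t : K) ≠ 0 := fun h0 => ht (by
      rw [show t = 0 from Subtype.ext h0]
      exact P.zero_mem)
    refine ⟨s * t, fun h => (hP.mem_or_mem h).elim hs ht, ?_⟩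
    have e : ((s * t : (algebraMap A K).range) : K) * c • x = a * (s * x) := by
      rw [Subring.smul_def, hc, smul_eq_mul]
      push_cast
      field_simp
    rw [e]
    exact mul_mem_of_mem_range a.2 hsx

/-- Inclusions of submodules of `K` may be checked on localizations. -/
lemma le_of_forall_extend_ofPrime_le {M N : Submodule A K}
    (h : ∀ (P : Ideal (algebraMap A K).range) [P.IsPrime],
      extend (LocalSubring.ofPrime (algebraMap A K).range P).toSubring M ≤
        extend (LocalSubring.ofPrime (algebraMap A K).range P).toSubring N) : M ≤ N := by
  intro y hy
  let 𝔞 : Ideal (algebraMap A K).range :=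
    { carrier := {c | (c : K) * y ∈ N}
      add_mem' := fun {c d} hc hd => by
        change ((c : K) + d) * y ∈ N
        rw [add_mul]
        exact add_mem hc hd
      zero_mem' := by
        change (0 : K) * y ∈ N
        rw [zero_mul]
        exact zero_mem _
      smul_mem' := fun c d hd => by
        change (c * d : K) * y ∈ N
        rw [mul_assoc]
        exact mul_mem_of_mem_range c.2 hd }
  suffices 𝔞 = ⊤ by
    have h1 : (1 : (algebraMap A K).range) ∈ 𝔞 := this ▸ Submodule.mem_top
    have h2 : (1 : K) * y ∈ N := h1
    rwa [one_mul] at h2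
  by_contra hne
  obtain ⟨P, hP, hle⟩ := Ideal.exists_le_maximal 𝔞 hne
  have := hP.isPrime
  obtain ⟨s, hs, hsy⟩ := exists_mul_mem_of_mem_extend_ofPrime (h P (subset_extend M hy))
  exact hs (hle hsy)

end LocalGlobal

/-! ### Local rings and centers on a variety -/

section Varieties

lemma exists_affineOpen_le_inf {V : Scheme.{u}} {U U' : V.affineOpens} {x : V} (hx : x ∈ U.1)
    (hx' : x ∈ U'.1) : ∃ W : V.affineOpens, x ∈ W.1 ∧ W ≤ U ∧ W ≤ U' := by
  obtain ⟨W, hW, hxW, hle⟩ :=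
    TopologicalSpace.Opens.isBasis_iff_nbhd.mp V.isBasis_affineOpens
      (show x ∈ U.1 ⊓ U'.1 from ⟨hx, hx'⟩)
  exact ⟨⟨W, hW⟩, hxW, hle.trans inf_le_left, hle.trans inf_le_right⟩

lemma finiteType_sections {k : Type u} [Field k] {V : Scheme.{u}}
    [V.Over (Spec (CommRingCat.of k))] [LocallyOfFiniteType (V ↘ Spec (CommRingCat.of k))]
    (U : V.affineOpens) : Algebra.FiniteType k Γ(V, U) := by
  have h1 := (V ↘ Spec (CommRingCat.of k)).finiteType_appLE (isAffineOpen_top _) U.2 le_top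
  have h2 : ((Scheme.ΓSpecIso (CommRingCat.of k)).inv.hom).FiniteType :=
    RingHom.FiniteType.of_surjective _
      (Scheme.ΓSpecIso (CommRingCat.of k)).symm.commRingCatIsoToRingEquiv.surjective
  exact h1.comp h2

variable {V : Scheme.{u}} [IsIntegral V]

/-- The local ring of `V` at `x`, as a local subring of the function field. -/
noncomputable def localRing (V : Scheme.{u}) [IsIntegral V] (x : V) :
    LocalSubring V.functionField :=
  LocalSubring.range (algebraMap (V.presheaf.stalk x) V.functionField)

lemma range_le_localRing {U : V.Opens} [Nonempty U] {x : V} (hx : x ∈ U) :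
    (algebraMap Γ(V, U) V.functionField).range ≤ (localRing V x).toSubring := by
  rintro _ ⟨a, rfl⟩
  exact ⟨V.presheaf.germ U x hx a, Scheme.algebraMap_germ_eq_germToFunctionField V hx a⟩

/-- The local rings of `V` at the points of an affine open are the localizations of its coordinate
ring. -/
lemma exists_localRing_eq_ofPrime (U : V.affineOpens) [Nonempty U.1] {x : V} (hx : x ∈ U.1) :
    ∃ (P : Ideal (algebraMap Γ(V, U) V.functionField).range) (_ : P.IsPrime),
      localRing V x = LocalSubring.ofPrime (algebraMap Γ(V, U) V.functionField).range P := by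
  obtain ⟨P, hP, hle⟩ := exists_ofPrime_le (range_le_localRing hx)
  refine ⟨P, hP, le_antisymm (le_of_inv_mem ?_ fun _ _ hx' => hle.1 hx') hle⟩
  rintro _ ⟨z, rfl⟩
  let := V.presheaf.algebra_section_stalk (U := U.1) ⟨x, hx⟩
  have := U.2.isLocalization_stalk ⟨x, hx⟩
  obtain ⟨a, s, rfl⟩ :=
    IsLocalization.exists_mk'_eq (U.2.primeIdealOf ⟨x, hx⟩).asIdeal.primeCompl z
  obtain ⟨w, hw⟩ := (IsLocalization.map_units (V.presheaf.stalk x) s).exists_right_inv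
  have ha := IsLocalization.mk'_spec (V.presheaf.stalk x) a s
  have hg : ∀ c : Γ(V, U.1), algebraMap (V.presheaf.stalk x) V.functionField
      (algebraMap Γ(V, U.1) (V.presheaf.stalk x) c) = algebraMap Γ(V, U.1) V.functionField c :=
    fun c => Scheme.algebraMap_germ_eq_germToFunctionField V hx c
  have hw' := congrArg (algebraMap (V.presheaf.stalk x) V.functionField) hw
  rw [map_mul, hg, map_one] at hw'
  have hC := LocalSubring.le_ofPrime (algebraMap Γ(V, U) V.functionField).range P
  have hinv : (algebraMap Γ(V, U.1) V.functionField s)⁻¹ ∈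
      (LocalSubring.ofPrime (algebraMap Γ(V, U) V.functionField).range P).toSubring := by
    refine inv_mem_of_le hle (hC ⟨s, rfl⟩) ?_
    rw [inv_eq_of_mul_eq_one_right hw']
    exact ⟨w, rfl⟩
  have ha' := congrArg (algebraMap (V.presheaf.stalk x) V.functionField) ha
  rw [map_mul, hg, hg] at ha'
  rw [(eq_mul_inv_iff_mul_eq₀ (left_ne_zero_of_mul_eq_one hw')).mpr ha']
  exact mul_mem (hC ⟨a, rfl⟩) hinv

/-- A local ring containing the coordinate ring of an affine open has a center there. -/
lemma exists_localRing_le (U : V.affineOpens) [Nonempty U.1] {O : LocalSubring V.functionField}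
    (hO : (algebraMap Γ(V, U) V.functionField).range ≤ O.toSubring) :
    ∃ x ∈ U.1, localRing V x ≤ O := by
  have hU : IsAffineOpen U.1 := U.2
  let φ : Γ(V, U.1) →+* O.toSubring :=
    (Subring.inclusion hO).comp (algebraMap Γ(V, U) V.functionField).rangeRestrict
  let y : PrimeSpectrum Γ(V, U.1) := PrimeSpectrum.comap φ (IsLocalRing.closedPoint O.toSubring)
  have hy : hU.fromSpec y ∈ U.1 := by
    have : hU.fromSpec y ∈ hU.fromSpec.opensRange := ⟨y, rfl⟩
    rwa [hU.opensRange_fromSpec] at this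
  have hunit : ∀ s : Γ(V, U), s ∉ y.asIdeal →
      (algebraMap Γ(V, U) V.functionField s)⁻¹ ∈ O.toSubring := by
    intro s hs
    obtain ⟨w, hw⟩ := (not_not.mp hs : IsUnit (φ s)).exists_right_inv
    have hw' : algebraMap Γ(V, U) V.functionField s * w = 1 := congrArg Subtype.val hw
    rw [inv_eq_of_mul_eq_one_right hw']
    exact w.2
  refine ⟨hU.fromSpec y, hy, ?_⟩
  let := V.presheaf.algebra_section_stalk (U := U.1) ⟨hU.fromSpec y, hy⟩
  have : IsLocalization.AtPrime (V.presheaf.stalk (hU.fromSpec y)) y.asIdeal :=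
    hU.isLocalization_stalk' y hy
  have hg : ∀ c : Γ(V, U.1), algebraMap (V.presheaf.stalk (hU.fromSpec y)) V.functionField
      (algebraMap Γ(V, U.1) (V.presheaf.stalk (hU.fromSpec y)) c) =
        algebraMap Γ(V, U.1) V.functionField c :=
    fun c => Scheme.algebraMap_germ_eq_germToFunctionField V hy c
  have hs0 : ∀ s : y.asIdeal.primeCompl, algebraMap Γ(V, U.1) V.functionField s ≠ 0 := by
    intro s
    rw [← hg, FaithfulSMul.algebraMap_eq_zero_iff .. |>.ne]
    exact (IsLocalization.map_units (V.presheaf.stalk (hU.fromSpec y)) s).ne_zero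
  have hfrac : ∀ z, ∃ a : Γ(V, U.1), ∃ s : y.asIdeal.primeCompl,
      z = IsLocalization.mk' (V.presheaf.stalk (hU.fromSpec y)) a s ∧
      algebraMap (V.presheaf.stalk (hU.fromSpec y)) V.functionField z =
        algebraMap Γ(V, U.1) V.functionField a * (algebraMap Γ(V, U.1) V.functionField s)⁻¹ := by
    intro z
    obtain ⟨a, s, rfl⟩ := IsLocalization.exists_mk'_eq y.asIdeal.primeCompl z
    refine ⟨a, s, rfl, ?_⟩
    have ha := congrArg (algebraMap (V.presheaf.stalk (hU.fromSpec y)) V.functionField)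
      (IsLocalization.mk'_spec (V.presheaf.stalk (hU.fromSpec y)) a s)
    rw [map_mul, hg, hg] at ha
    exact (eq_mul_inv_iff_mul_eq₀ (hs0 s)).mpr ha
  refine le_of_inv_mem ?_ ?_
  · rintro _ ⟨z, rfl⟩
    obtain ⟨a, s, -, h⟩ := hfrac z
    rw [h]
    exact mul_mem (hO ⟨a, rfl⟩) (hunit s s.2)
  · rintro _ ⟨z, rfl⟩ hz
    obtain ⟨a, s, rfl, h⟩ := hfrac z
    rw [h] at hz ⊢
    rcases eq_or_ne (algebraMap Γ(V, U.1) V.functionField a) 0 with h0 | h0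
    · rw [h0, zero_mul, inv_zero]
      exact zero_mem _
    have ha : a ∉ y.asIdeal := by
      intro ha
      refine ha (IsUnit.of_mul_eq_one
        ⟨(algebraMap Γ(V, U.1) V.functionField a)⁻¹, ?_⟩ (Subtype.ext (mul_inv_cancel₀ h0)))
      have e : (algebraMap Γ(V, U.1) V.functionField a)⁻¹ =
          (algebraMap Γ(V, U.1) V.functionField a *
            (algebraMap Γ(V, U.1) V.functionField s)⁻¹)⁻¹ *
          (algebraMap Γ(V, U.1) V.functionField s)⁻¹ := by
        have := hs0 s
        field_simp
      rw [e]
      exact mul_mem hz (hunit s s.2)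
    obtain ⟨w, hw⟩ := (IsLocalization.map_units (V.presheaf.stalk (hU.fromSpec y))
      (⟨a, ha⟩ : y.asIdeal.primeCompl)).exists_right_inv
    have hw' := congrArg (algebraMap (V.presheaf.stalk (hU.fromSpec y)) V.functionField) hw
    rw [map_mul, hg, map_one] at hw'
    rw [mul_inv, inv_inv, inv_eq_of_mul_eq_one_right hw']
    exact mul_mem ⟨w, rfl⟩ (range_le_localRing hy ⟨s, rfl⟩)

lemma exists_ofPrime_eq_localRing (U : V.affineOpens) [Nonempty U.1]
    (P : Ideal (algebraMap Γ(V, U) V.functionField).range) [P.IsPrime] :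
    ∃ x ∈ U.1, LocalSubring.ofPrime (algebraMap Γ(V, U) V.functionField).range P =
      localRing V x := by
  obtain ⟨x, hx, hle⟩ := exists_localRing_le U (LocalSubring.le_ofPrime _ P)
  exact ⟨x, hx, le_antisymm (ofPrime_le_of_le hle (range_le_localRing hx)) hle⟩

/-- On a separated scheme a local ring of the function field dominates the local ring of at most
one point: the two maps from its spectrum to `V` agree at the generic point. -/
lemma eq_of_localRing_le {S : Scheme.{u}} [S.IsSeparated] (f : V ⟶ S) [IsSeparated f] {x y : V}
    {O : LocalSubring V.functionField} (hx : localRing V x ≤ O) (hy : localRing V y ≤ O) :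
    x = y := by
  let φ (x : V) (hx : localRing V x ≤ O) : V.presheaf.stalk x →+* O.toSubring :=
    (Subring.inclusion hx.1).comp
      (algebraMap (V.presheaf.stalk x) V.functionField).rangeRestrict
  have hφ : ∀ x hx, IsLocalHom (φ x hx) := fun x hx =>
    have := hx.2
    have h2 : IsLocalHom (algebraMap (V.presheaf.stalk x) V.functionField).rangeRestrict :=
      IsLocalHom.of_surjective _ (RingHom.rangeRestrict_surjective _)
    @RingHom.isLocalHom_comp _ _ _ _ _ _ _ _ this h2
  let g (x : V) (hx : localRing V x ≤ O) : Spec (CommRingCat.of O.toSubring) ⟶ V :=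
    Spec.map (CommRingCat.ofHom (φ x hx)) ≫ V.fromSpecStalk x
  let p : Spec (CommRingCat.of O.toSubring) := IsLocalRing.closedPoint O.toSubring
  have hg : ∀ x hx, g x hx p = x := by
    intro x hx
    have := hφ x hx
    have hp : Spec.map (CommRingCat.ofHom (φ x hx)) p =
        IsLocalRing.closedPoint (V.presheaf.stalk x) := IsLocalRing.comap_closedPoint (φ x hx)
    change (Spec.map (CommRingCat.ofHom (φ x hx)) ≫ V.fromSpecStalk x) p = x
    rw [Scheme.Hom.comp_apply, hp]
    exact Scheme.fromSpecStalk_closedPoint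
  let ι : Spec V.functionField ⟶ Spec (CommRingCat.of O.toSubring) :=
    Spec.map (CommRingCat.ofHom O.toSubring.subtype)
  have hι : IsDominant ι := by
    refine ⟨?_⟩
    refine (PrimeSpectrum.denseRange_comap_iff_ker_le_nilRadical O.toSubring.subtype).mpr ?_
    rw [(RingHom.injective_iff_ker_eq_bot _).mp O.toSubring.subtype_injective]
    exact bot_le
  have hιg : ∀ x hx, ι ≫ g x hx = V.fromSpecStalk (genericPoint V) := by
    intro x hx
    rw [← Scheme.SpecMap_stalkSpecializes_fromSpecStalk
      ((genericPoint_spec V).specializes (Set.mem_univ x)), ← Category.assoc]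
    refine congrArg (· ≫ V.fromSpecStalk x) ?_
    change Spec.map (CommRingCat.ofHom O.toSubring.subtype) ≫
      Spec.map (CommRingCat.ofHom (φ x hx)) = _
    rw [← Spec.map_comp]
    rfl
  have : V.IsSeparated := ⟨by
    rw [← Limits.terminal.comp_from f]
    have : IsSeparated (Limits.terminal.from S) := Scheme.IsSeparated.isSeparated_terminal_from
    infer_instance⟩
  have h := ext_of_isDominant (f := g x hx) (g := g y hy) ι ((hιg x hx).trans (hιg y hy).symm)
  rw [← hg x hx, h, hg y hy]

lemma algebraMap_map_res {U W : V.Opens} [Nonempty U] [Nonempty W] (h : W ≤ U) (a : Γ(V, U)) :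
    algebraMap Γ(V, W) V.functionField ((V.presheaf.map (homOfLE h).op).hom a) =
      algebraMap Γ(V, U) V.functionField a := by
  change (V.germToFunctionField W).hom _ = (V.germToFunctionField U).hom a
  erw [V.presheaf.germ_res_apply]

lemma extend_sections (I : V.IdealSheafData) {U W : V.affineOpens} [Nonempty U.1] [Nonempty W.1]
    (h : W ≤ U) : extend Γ(V, W) (sections I U) = sections I W := by
  rw [sections, sections, ← I.map_ideal h, Ideal.map, Ideal.span, Submodule.map_span]
  refine congrArg (Submodule.span Γ(V, W)) ?_
  ext y
  constructor
  · rintro ⟨a, ha, rfl⟩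
    exact ⟨_, ⟨a, ha, rfl⟩, algebraMap_map_res h a⟩
  · rintro ⟨_, ⟨a, ha, rfl⟩, rfl⟩
    exact ⟨a, ha, (algebraMap_map_res h a).symm⟩

lemma extend_localRing_sections (I : V.IdealSheafData) {U U' : V.affineOpens} [Nonempty U.1]
    [Nonempty U'.1] {x : V} (hx : x ∈ U.1) (hx' : x ∈ U'.1) :
    extend (localRing V x).toSubring (sections I U) =
      extend (localRing V x).toSubring (sections I U') := by
  obtain ⟨W, hxW, hWU, hWU'⟩ := exists_affineOpen_le_inf hx hx'
  have : Nonempty W.1 := ⟨⟨x, hxW⟩⟩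
  have h : (algebraMap Γ(V, W) V.functionField).range ≤
      (algebraMap (localRing V x).toSubring V.functionField).range := by
    rw [algebraMap_subring_range]
    exact range_le_localRing hxW
  rw [← extend_extend h (sections I U), ← extend_extend h (sections I U'), extend_sections I hWU,
    extend_sections I hWU']

lemma sections_ne_bot {I : V.IdealSheafData} (hI : I ≠ ⊥) (U : V.affineOpens) [Nonempty U.1] :
    sections I U ≠ ⊥ := by
  intro h
  apply hI
  ext U' a
  rw [Scheme.IdealSheafData.ideal_bot]
  refine ⟨fun ha => ?_, fun ha => by rw [(Submodule.mem_bot _).mp ha]; exact zero_mem _⟩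
  by_cases hU' : Nonempty U'.1
  · have hmem : ∀ U : V.affineOpens, Nonempty U.1 → genericPoint V ∈ U.1 := fun U hU =>
      ((genericPoint_spec V).mem_open_set_iff U.1.isOpen).mpr (by simpa using hU)
    have h1 : algebraMap Γ(V, U') V.functionField a ∈
        extend (localRing V (genericPoint V)).toSubring (sections I U') :=
      subset_extend _ ⟨a, ha, rfl⟩
    rw [extend_localRing_sections I (hmem U' hU') (hmem U ‹_›), h, extend,
      Submodule.bot_coe, Submodule.span_zero_singleton, Submodule.mem_bot] at h1
    exact (Submodule.mem_bot _).mpr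
      (Scheme.germToFunctionField_injective V U'.1 (h1.trans (map_zero _).symm))
  · have hbot : U'.1 = ⊥ := by
      ext z
      exact ⟨fun hz => (hU' ⟨⟨z, hz⟩⟩).elim, fun hz => hz.elim⟩
    have : Subsingleton Γ(V, U'.1) := by
      rw [hbot]
      infer_instance
    exact Subsingleton.elim (α := Γ(V, U'.1)) a 0

/-! ### The Gauss process on a variety -/

section Foliated

variable {k : Type u} [Field k] [V.Over (Spec (CommRingCat.of k))] {r : ℕ}
variable (δ : Fin r → Derivation k V.functionField V.functionField) (I : V.IdealSheafData)

lemma extend_localRing_J {U U' : V.affineOpens} [Nonempty U.1] [Nonempty U'.1] {x : V}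
    (hx : x ∈ U.1) (hx' : x ∈ U'.1) (n : ℕ) :
    extend (localRing V x).toSubring (J δ (sections I U) n) =
      extend (localRing V x).toSubring (J δ (sections I U') n) := by
  have key : ∀ (U : V.affineOpens) [Nonempty U.1], x ∈ U.1 →
      extend (localRing V x).toSubring (J δ (sections I U) n) =
        J δ (extend (localRing V x).toSubring (sections I U)) n := by
    intro U _ hx
    obtain ⟨P, hP, h⟩ := exists_localRing_eq_ofPrime U hx
    rw [h, extend_J_ofPrime]
  rw [key U hx, key U' hx', extend_localRing_sections I hx hx']

lemma extend_localRing_L {U U' : V.affineOpens} [Nonempty U.1] [Nonempty U'.1] {x : V}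
    (hx : x ∈ U.1) (hx' : x ∈ U'.1) (n : ℕ) :
    extend (localRing V x).toSubring (L δ (sections I U) n) =
      extend (localRing V x).toSubring (L δ (sections I U') n) := by
  have key : ∀ (U : V.affineOpens) [Nonempty U.1], x ∈ U.1 →
      extend (localRing V x).toSubring (L δ (sections I U) n) =
        F δ (extend (localRing V x).toSubring (J δ (sections I U) n)) := by
    intro U _ hx
    obtain ⟨P, hP, h⟩ := exists_localRing_eq_ofPrime U hx
    rw [h, F_extend_ofPrime]
    rfl
  rw [key U hx, key U' hx', extend_localRing_J δ I hx hx']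

/-- The `n`-th stage of the Gauss process is the blowup along `Jₙ`. -/
lemma tower_eq (n : ℕ) : tower δ I n =
    ⋃ (U : V.affineOpens) (_ : Nonempty U.1), blowup (J δ (sections I U) n) := by
  induction n with
  | zero => rfl
  | succ n ih =>
    rw [tower, ih]
    simp only [gaussBlowup_iUnion, gaussBlowup_blowup]
    rfl

lemma tower_add_eq {N : ℕ} (h : tower δ I (N + 1) = tower δ I N) (n : ℕ) (hn : N ≤ n) :
    tower δ I n = tower δ I N := by
  induction n, hn using Nat.le_induction with
  | base => rfl
  | succ n _ ih => rw [← h, tower, ih, tower]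

/-- The equality `Lₜʳ⁺² = Lₜ₊₁` is local on `V`. -/
lemma L_pow_eq_of_cover {t : ℕ}
    (h : ∀ x : V, ∃ (U : V.affineOpens) (_ : Nonempty U.1), x ∈ U.1 ∧
      L δ (sections I U) t ^ (r + 2) = L δ (sections I U) (t + 1))
    (U : V.affineOpens) [Nonempty U.1] :
    L δ (sections I U) t ^ (r + 2) = L δ (sections I U) (t + 1) := by
  have key : ∀ (P : Ideal (algebraMap Γ(V, U) V.functionField).range) [P.IsPrime],
      extend (LocalSubring.ofPrime (algebraMap Γ(V, U) V.functionField).range P).toSubring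
        (L δ (sections I U) t ^ (r + 2)) =
      extend (LocalSubring.ofPrime (algebraMap Γ(V, U) V.functionField).range P).toSubring
        (L δ (sections I U) (t + 1)) := by
    intro P _
    obtain ⟨x, hx, hP⟩ := exists_ofPrime_eq_localRing U P
    obtain ⟨U', _, hx', hU'⟩ := h x
    have hr : ∀ (U : V.affineOpens) [Nonempty U.1], x ∈ U.1 →
        (algebraMap Γ(V, U) V.functionField).range ≤
          (algebraMap (localRing V x).toSubring V.functionField).range := by
      intro U _ hx
      rw [algebraMap_subring_range]
      exact range_le_localRing hx
    rw [hP, extend_pow (hr U hx), extend_localRing_L δ I hx hx', ← extend_pow (hr U' hx'), hU',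
      extend_localRing_L δ I hx' hx]
  exact le_antisymm (le_of_forall_extend_ofPrime_le fun P _ => (key P).le)
    (le_of_forall_extend_ofPrime_le fun P _ => (key P).ge)

/-- A local ring of the `n`-th blowup that contains the coordinate ring of an affine open lies over
that affine open, by separatedness, and there `Lₙ = Jₙʳ⁺¹ ⋀ʳ Ω`. -/
lemma extend_L_of_mem_tower [IsSeparated (V ↘ Spec (CommRingCat.of k))] (U : V.affineOpens)
    [Nonempty U.1] {O : LocalSubring V.functionField}
    (hUO : (algebraMap Γ(V, U) V.functionField).range ≤ O.toSubring) {n : ℕ}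
    (hO : O ∈ tower δ I n) :
    extend O.toSubring (L δ (sections I U) n) =
      extend O.toSubring (J δ (sections I U) n) ^ (r + 1) * canonical δ O.toSubring := by
  rw [tower_eq] at hO
  simp only [Set.mem_iUnion] at hO
  obtain ⟨U', _, hO⟩ := hO
  obtain ⟨x, hx, hxO⟩ := exists_localRing_le U hUO
  obtain ⟨x', hx', hxO'⟩ := exists_localRing_le U' (mem_blowup_iff.mp hO).prop.1
  obtain rfl := eq_of_localRing_le (V ↘ Spec (CommRingCat.of k)) hxO hxO'
  have h : (algebraMap (localRing V x).toSubring V.functionField).range ≤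
      (algebraMap O.toSubring V.functionField).range := by
    rw [algebraMap_subring_range, algebraMap_subring_range]
    exact hxO.1
  rw [← extend_extend h (L δ (sections I U) n), extend_localRing_L δ I hx hx', extend_extend h,
    ← extend_extend h (J δ (sections I U) n), extend_localRing_J δ I hx hx', extend_extend h]
  exact extend_F_of_mem_blowup δ hO

/-- If the tower is stationary from `N` on then `Lₙ₊₁ = Lₙʳ⁺²` over every valuation ring, for
`n ≥ N`. -/
lemma extend_L_succ_of_tower_eq [IsSeparated (V ↘ Spec (CommRingCat.of k))]
    [LocallyOfFiniteType (V ↘ Spec (CommRingCat.of k))] (hδ : LinearIndependent V.functionField δ)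
    (hI : I ≠ ⊥) {N : ℕ} (hN : ∀ n ≥ N, tower δ I n = tower δ I N) (U : V.affineOpens)
    [Nonempty U.1] (hfg : (sections I U).FG) (W : ValuationSubring V.functionField)
    (hW : (algebraMap Γ(V, U) V.functionField).range ≤ W.toSubring) (n : ℕ) (hn : n ≥ N) :
    extend W.toSubring (L δ (sections I U) (n + 1)) =
      extend W.toSubring (L δ (sections I U) n) ^ (r + 2) := by
  have := functionField_isFractionRing_of_isAffineOpen V U.1 U.2
  have := finiteType_sections (k := k) U
  obtain ⟨O, hO, hOW⟩ := exists_mem_blowup_le (O := W.toLocalSubring)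
    ⟨hW, principalOn_valuationSubring (J_fg δ hfg N)
      (J_ne_bot δ hδ (sections_ne_bot hI U) N) W hW⟩
  have hUO := (mem_blowup_iff.mp hO).prop.1
  have hON : O ∈ tower δ I N := by
    rw [tower_eq]
    simp only [Set.mem_iUnion]
    exact ⟨U, ‹_›, hO⟩
  have hL : ∀ m ≥ N, extend O.toSubring (L δ (sections I U) m) =
      extend O.toSubring (J δ (sections I U) m) ^ (r + 1) * canonical δ O.toSubring :=
    fun m hm => extend_L_of_mem_tower δ I U hUO (by rwa [hN m hm])
  have hUO' : (algebraMap Γ(V, U) V.functionField).range ≤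
      (algebraMap O.toSubring V.functionField).range := by
    rwa [algebraMap_subring_range]
  have hJ : extend O.toSubring (J δ (sections I U) (n + 1)) =
      extend O.toSubring (J δ (sections I U) n) * extend O.toSubring (L δ (sections I U) n) := by
    rw [← extend_mul hUO']
    rfl
  have key : extend O.toSubring (L δ (sections I U) (n + 1)) =
      extend O.toSubring (L δ (sections I U) n ^ (r + 2)) := by
    rw [hL (n + 1) (by omega), hJ, extend_pow hUO', mul_pow, pow_succ _ (r + 1), mul_right_comm,
      ← hL n hn, mul_comm]
  have hOW' : (algebraMap O.toSubring V.functionField).range ≤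
      (algebraMap W.toSubring V.functionField).range := by
    rw [algebraMap_subring_range, algebraMap_subring_range]
    exact hOW.1
  have hUW : (algebraMap Γ(V, U) V.functionField).range ≤
      (algebraMap W.toSubring V.functionField).range := hUO'.trans hOW'
  rw [← extend_extend hOW', key, extend_extend hOW', extend_pow hUW]

end Foliated

end Varieties

/-! ### The equivalences -/

section Equivalences

variable {k : Type u} [Field k] {V : Scheme.{u}} [V.Over (Spec (CommRingCat.of k))]
  [IsIntegral V]
variable {r : ℕ} (δ : Fin r → Derivation k V.functionField V.functionField) (I : V.IdealSheafData)

lemma tower_stabilizes_of_L_pow_eq {t : ℕ}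
    (h : ∀ (U : V.affineOpens) [Nonempty U.1],
      L δ (sections I U) t ^ (r + 2) = L δ (sections I U) (t + 1)) :
    ∀ n ≥ t + 1, tower δ I (n + 1) = tower δ I n := by
  have h1 : tower δ I (t + 2) = tower δ I (t + 1) := by
    rw [tower_eq, tower_eq]
    exact Set.iUnion_congr fun U => Set.iUnion_congr fun _ => blowup_J_succ_succ δ (h U)
  intro n hn
  rw [tower_add_eq δ I h1 (n + 1) (by omega), tower_add_eq δ I h1 n hn]

variable [CharZero k]

lemma exists_L_pow_eq_of_forall_finiteType [QuasiCompact (V ↘ Spec (CommRingCat.of k))]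
    (h : ∀ (U : V.affineOpens) [Nonempty U.1], Algebra.FiniteType k (R δ (sections I U))) :
    ∃ t, ∀ (U : V.affineOpens) [Nonempty U.1],
      L δ (sections I U) t ^ (r + 2) = L δ (sections I U) (t + 1) := by
  have hT : ∀ x : V, ∃ (U : V.affineOpens) (_ : Nonempty U.1) (T : ℕ), x ∈ U.1 ∧
      ∀ t ≥ T, L δ (sections I U) t ^ (r + 2) = L δ (sections I U) (t + 1) := by
    intro x
    obtain ⟨U, hU, hx, -⟩ :=
      TopologicalSpace.Opens.isBasis_iff_nbhd.mp V.isBasis_affineOpens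
        (TopologicalSpace.Opens.mem_top x)
    have : Nonempty U := ⟨⟨x, hx⟩⟩
    obtain ⟨T, hT⟩ := exists_L_pow_eq_of_finiteType δ (h ⟨U, hU⟩)
    exact ⟨⟨U, hU⟩, this, T, hx, hT⟩
  choose U hU T hxU hT using hT
  have : CompactSpace V :=
    QuasiCompact.compactSpace_of_compactSpace (V ↘ Spec (CommRingCat.of k))
  obtain ⟨s, hs⟩ := CompactSpace.elim_nhds_subcover (fun x => ((U x).1 : Set V))
    fun x => (U x).1.isOpen.mem_nhds (hxU x)
  refine ⟨s.sup T, fun U' _ => L_pow_eq_of_cover δ I (fun x => ?_) U'⟩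
  have hx : x ∈ ⋃ y ∈ s, ((U y).1 : Set V) := hs ▸ Set.mem_univ x
  simp only [Set.mem_iUnion] at hx
  obtain ⟨y, hy, hxy⟩ := hx
  exact ⟨U y, hU y, hxy, hT y _ (Finset.le_sup hy)⟩

lemma finiteType_of_tower_stabilizes [IsSeparated (V ↘ Spec (CommRingCat.of k))]
    [LocallyOfFiniteType (V ↘ Spec (CommRingCat.of k))] (hδ : LinearIndependent V.functionField δ)
    (hI : I ≠ ⊥) {N : ℕ} (hN : ∀ n ≥ N, tower δ I (n + 1) = tower δ I n) (U : V.affineOpens)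
    [Nonempty U.1] : Algebra.FiniteType k (R δ (sections I U)) := by
  have := functionField_isFractionRing_of_isAffineOpen V U.1 U.2
  have := finiteType_sections (k := k) U
  have : IsNoetherianRing Γ(V, U) := Algebra.FiniteType.isNoetherianRing k _
  have hfg : (sections I U).FG := (IsNoetherian.noetherian (I.ideal U)).map _
  exact R_finiteType δ hδ hfg (sections_ne_bot hI U) N
    (extend_L_succ_of_tower_eq δ I hδ hI (tower_add_eq δ I (hN N le_rfl)) U hfg)

lemma naturalMap_bijective_iff {K A : Type*} [Field K] [Algebra k K] [CommRing A] [Algebra A K]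
    [Algebra k A] [IsScalarTower k A K] (δ : Fin r → Derivation k K K) (M : Submodule A K) :
    Function.Bijective (naturalMap δ M) ↔ F δ M ^ (r + 2) = F δ (M * F δ M) := by
  refine ⟨fun h => le_antisymm (F_pow_le (k := k) δ M) fun y hy => ?_, fun h => ?_⟩
  · obtain ⟨x, hx⟩ := h.2 ⟨y, hy⟩
    have : (x : K) = y := congrArg Subtype.val hx
    exact this ▸ x.2
  · exact ⟨Submodule.inclusion_injective _, fun y => ⟨⟨y, h.ge y.2⟩, rfl⟩⟩

end Equivalences

end GaussProcess

theorem theorem3 {k : Type u} [Field k] [CharZero k]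
    (V : Scheme.{u}) [V.Over (Spec (CommRingCat.of k))] [IsIntegral V]
    [IsSeparated (V ↘ Spec (CommRingCat.of k))]
    [LocallyOfFiniteType (V ↘ Spec (CommRingCat.of k))]
    [QuasiCompact (V ↘ Spec (CommRingCat.of k))]
    (𝓕 : GaussProcess.SingularFoliation k V.functionField) (r : ℕ)
    (b : Module.Basis (Fin r) V.functionField 𝓕.toSubmodule)
    (δ : Fin r → Derivation k V.functionField V.functionField) (hδ : ∀ i, δ i = b i)
    (I : V.IdealSheafData) (hI : I ≠ ⊥) :
    List.TFAE
      [∀ (U : V.affineOpens) [Nonempty U.1],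
         Algebra.FiniteType k (GaussProcess.R δ (GaussProcess.sections I U)),
       ∃ N : ℕ, ∀ n ≥ N, GaussProcess.tower δ I (n + 1) = GaussProcess.tower δ I n,
       ∃ t : ℕ, ∀ (U : V.affineOpens) [Nonempty U.1],
         Function.Bijective
           (GaussProcess.naturalMap δ (GaussProcess.J δ (GaussProcess.sections I U) t))] := by
  have hδ' : LinearIndependent V.functionField δ := by
    rw [funext hδ]
    exact b.linearIndependent.map' 𝓕.toSubmodule.subtype (Submodule.ker_subtype _)
  have h3 : ∀ t : ℕ, (∀ (U : V.affineOpens) [Nonempty U.1], Function.Bijective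
      (GaussProcess.naturalMap δ (GaussProcess.J δ (GaussProcess.sections I U) t))) ↔
      ∀ (U : V.affineOpens) [Nonempty U.1],
        GaussProcess.L δ (GaussProcess.sections I U) t ^ (r + 2) =
        GaussProcess.L δ (GaussProcess.sections I U) (t + 1) := fun t =>
    forall_congr' fun U => forall_congr' fun _ => GaussProcess.naturalMap_bijective_iff δ _
  tfae_have 1 → 3 := fun h => by
    simp only [h3]
    exact GaussProcess.exists_L_pow_eq_of_forall_finiteType δ I h
  tfae_have 3 → 2 := fun ⟨t, ht⟩ =>
    ⟨t + 1, GaussProcess.tower_stabilizes_of_L_pow_eq δ I ((h3 t).mp ht)⟩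
  tfae_have 2 → 1 := fun ⟨_, hN⟩ U _ =>
    GaussProcess.finiteType_of_tower_stabilizes δ I hδ' hI hN U
  tfae_finish
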